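/- All manifolds and maps are of class $C^\infty$. Let $n\ge 0$ and let $M$ be a $(4n+3)$-dimensional manifold (without boundary). An almost cocomplex structure on $M$ is a triple $(\phi,\xi,\eta)$ of a $(1,1)$-tensor field, a vector field and a $1$-form with $\phi^2=-I+\xi\otimes\eta$, $\eta(\xi)=1$, $\phi\xi=0$, $\eta\circ\phi=0$, where $(\xi\otimes\eta)(X)=\eta(X)\xi$. An almost coquaternion structure on $M$ consists of three almost cocomplex structures $(\phi_a,\xi_a,\eta_a)$, $a=1,2,3$, such that for every cyclic permutation $(a,b,c)$ of $(1,2,3)$ $$\phi_a\phi_b-\xi_a\otimes\eta_b=-\phi_b\phi_a+\xi_b\otimes\eta_a=\phi_c,\qquad \phi_a\xi_b=-\phi_b\xi_a=\xi_c,$$ $$\eta_a\circ\phi_b=-\eta_b\circ\phi_a=\eta_c,\qquad \eta_a(\xi_b)=\eta_b(\xi_a)=0 .$$ An almost coquaternion metric structure is such a structure together with a Riemannian metric $g$ on $M$ with $\eta_a(X)=g(\xi_a,X)$ and $g(\phi_aX,\phi_aY)=g(X,Y)-\eta_a(X)\eta_a(Y)$ for $a=1,2,3$ and all vector fields $X,Y$.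 Let $GL(n,\mathbb H)\times1\times1\times1$ act on $\mathbb H^n\times\mathbb R\times\mathbb R\times\mathbb R\cong\mathbb R^{4n+3}$ by $(q,t)\mapsto(Aq,t)$, and let $Sp(n)=\{A\in GL(n,\mathbb H): A^*A=I\}$. The structure group of $TM$ reduces to a closed group $G$ of linear automorphisms of $\mathbb H^n\times\mathbb R^3$ if $TM$ has smooth local trivializations, with fibre $\mathbb H^n\times\mathbb R^3$ and over open sets covering $M$, whose transition functions take values in $G$. Theorem 1.7. (i) $M$ admits an almost coquaternion structure if and only if the structure group of $TM$ reduces to $GL(n,\mathbb H)\times1\times1\times1$. (ii) $M$ admits an almost coquaternion metric structure if and only if the structure group of $TM$ reduces to $Sp(n)\times1\times1\times1$. (iii) If $M$ admits an almost coquaternion structure, then $M$ is orientable, that is, it is covered by charts of its smooth structure all of whose transition maps have positive Jacobian determinant. -/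

import Mathlib

open scoped Manifold ContDiff Quaternion

noncomputable section

/-- An almost cocomplex (almost contact) structure `(φ, ξ, η)` on a smooth `m`-manifold `M`: a smooth
field `φ` of endomorphisms of the tangent spaces, a smooth vector field `ξ` and a smooth `1`-form `η`
with `φ² = -I + ξ ⊗ η`, `η(ξ) = 1`, `φ ξ = 0`, `η ∘ φ = 0`, where `(ξ ⊗ η)(v) = η(v) ξ`. -/
structure AlmostCocomplexStructure (m : ℕ) (M : Type*) [TopologicalSpace M]
    [ChartedSpace (EuclideanSpace ℝ (Fin m)) M] [IsManifold (𝓡 m) ∞ M] where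
  /-- the endomorphism field -/
  φ : ∀ x : M, TangentSpace (𝓡 m) x →L[ℝ] TangentSpace (𝓡 m) x
  /-- the vector field -/
  ξ : ∀ x : M, TangentSpace (𝓡 m) x
  /-- the `1`-form -/
  η : ∀ x : M, TangentSpace (𝓡 m) x →L[ℝ] ℝ
  contMDiff_φ : ContMDiff (𝓡 m)
    ((𝓡 m).prod 𝓘(ℝ, EuclideanSpace ℝ (Fin m) →L[ℝ] EuclideanSpace ℝ (Fin m))) ∞
    (fun x ↦ Bundle.TotalSpace.mk' (EuclideanSpace ℝ (Fin m) →L[ℝ] EuclideanSpace ℝ (Fin m))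
      (E := fun x : M ↦ TangentSpace (𝓡 m) x →L[ℝ] TangentSpace (𝓡 m) x) x (φ x))
  contMDiff_ξ : ContMDiff (𝓡 m) (𝓡 m).tangent ∞
    (fun x ↦ (⟨x, ξ x⟩ : TangentBundle (𝓡 m) M))
  contMDiff_η : ContMDiff (𝓡 m) ((𝓡 m).prod 𝓘(ℝ, EuclideanSpace ℝ (Fin m) →L[ℝ] ℝ)) ∞
    (fun x ↦ Bundle.TotalSpace.mk' (EuclideanSpace ℝ (Fin m) →L[ℝ] ℝ)
      (E := fun x : M ↦ TangentSpace (𝓡 m) x →L[ℝ] Bundle.Trivial M ℝ x) x (η x))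
  φ_φ : ∀ (x : M) (v : TangentSpace (𝓡 m) x), φ x (φ x v) = -v + η x v • ξ x
  η_ξ : ∀ x : M, η x (ξ x) = 1
  φ_ξ : ∀ x : M, φ x (ξ x) = 0
  η_φ : ∀ (x : M) (v : TangentSpace (𝓡 m) x), η x (φ x v) = 0

/-- An almost coquaternion structure on a smooth `m`-manifold `M`: three almost cocomplex structures
`(φ_a, ξ_a, η_a)` satisfying, for every cyclic permutation `(a, b, c)` of the three indices,
`φ_a φ_b - ξ_a ⊗ η_b = -φ_b φ_a + ξ_b ⊗ η_a = φ_c`, `φ_a ξ_b = -φ_b ξ_a = ξ_c`,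
`η_a ∘ φ_b = -η_b ∘ φ_a = η_c` and `η_a(ξ_b) = η_b(ξ_a) = 0`.
The indices are `0, 1, 2 : Fin 3`, and the cyclic permutations are the `(a, a + 1, a + 2)`. -/
structure AlmostCoquaternionStructure (m : ℕ) (M : Type*) [TopologicalSpace M]
    [ChartedSpace (EuclideanSpace ℝ (Fin m)) M] [IsManifold (𝓡 m) ∞ M] where
  /-- the three almost cocomplex structures -/
  str : Fin 3 → AlmostCocomplexStructure m M
  φ_φ_left : ∀ (a : Fin 3) (x : M) (v : TangentSpace (𝓡 m) x),
    (str a).φ x ((str (a + 1)).φ x v) - (str (a + 1)).η x v • (str a).ξ x = (str (a + 2)).φ x v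
  φ_φ_right : ∀ (a : Fin 3) (x : M) (v : TangentSpace (𝓡 m) x),
    -(str (a + 1)).φ x ((str a).φ x v) + (str a).η x v • (str (a + 1)).ξ x = (str (a + 2)).φ x v
  φ_ξ_left : ∀ (a : Fin 3) (x : M), (str a).φ x ((str (a + 1)).ξ x) = (str (a + 2)).ξ x
  φ_ξ_right : ∀ (a : Fin 3) (x : M), -(str (a + 1)).φ x ((str a).ξ x) = (str (a + 2)).ξ x
  η_φ_left : ∀ (a : Fin 3) (x : M) (v : TangentSpace (𝓡 m) x),
    (str a).η x ((str (a + 1)).φ x v) = (str (a + 2)).η x v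
  η_φ_right : ∀ (a : Fin 3) (x : M) (v : TangentSpace (𝓡 m) x),
    -(str (a + 1)).η x ((str a).φ x v) = (str (a + 2)).η x v
  η_ξ_left : ∀ (a : Fin 3) (x : M), (str a).η x ((str (a + 1)).ξ x) = 0
  η_ξ_right : ∀ (a : Fin 3) (x : M), (str (a + 1)).η x ((str a).ξ x) = 0

/-- An almost coquaternion metric structure: an almost coquaternion structure together with a smooth
(positive definite) Riemannian metric `g` with `η_a(v) = g(ξ_a, v)` and
`g(φ_a v, φ_a w) = g(v, w) - η_a(v) η_a(w)` for the three values of `a`. -/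
structure AlmostCoquaternionMetricStructure (m : ℕ) (M : Type*) [TopologicalSpace M]
    [ChartedSpace (EuclideanSpace ℝ (Fin m)) M] [IsManifold (𝓡 m) ∞ M] extends
    AlmostCoquaternionStructure m M where
  /-- the Riemannian metric -/
  g : Bundle.ContMDiffRiemannianMetric (𝓡 m) ∞ (EuclideanSpace ℝ (Fin m))
    (fun x : M ↦ TangentSpace (𝓡 m) x)
  η_eq : ∀ (a : Fin 3) (x : M) (v : TangentSpace (𝓡 m) x),
    (str a).η x v = g.inner x ((str a).ξ x) v
  inner_φ_φ : ∀ (a : Fin 3) (x : M) (v w : TangentSpace (𝓡 m) x),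
    g.inner x ((str a).φ x v) ((str a).φ x w) = g.inner x v w - (str a).η x v * (str a).η x w

/-- The real vector space `ℍⁿ × ℝ × ℝ × ℝ`, of dimension `4n + 3`. -/
abbrev CoquaternionModel (n : ℕ) : Type := (Fin n → ℍ) × (Fin 3 → ℝ)

/-- The action of an invertible quaternionic matrix `A` on `ℍⁿ × ℝ × ℝ × ℝ`, `(q, t) ↦ (A q, t)`. -/
def coquaternionAct (n : ℕ) (A : (Matrix (Fin n) (Fin n) ℍ)ˣ) :
    CoquaternionModel n ≃L[ℝ] CoquaternionModel n :=
  LinearEquiv.toContinuousLinearEquiv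
    { toFun := fun v ↦ (A.val.mulVec v.1, v.2)
      invFun := fun v ↦ (A.inv.mulVec v.1, v.2)
      map_add' := fun v w ↦ by simp [Matrix.mulVec_add]
      map_smul' := fun r v ↦ by simp [Matrix.mulVec_smul]
      left_inv := fun v ↦ by simp [Matrix.mulVec_mulVec]
      right_inv := fun v ↦ by simp [Matrix.mulVec_mulVec] }

theorem coquaternionAct_apply (n : ℕ) (A : (Matrix (Fin n) (Fin n) ℍ)ˣ) (v : CoquaternionModel n) :
    coquaternionAct n A v = (A.val.mulVec v.1, v.2) := rfl

/-- The real representation of `GL(n, ℍ) × 1 × 1 × 1` on `ℍⁿ × ℝ × ℝ × ℝ`. -/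
def coquaternionRep (n : ℕ) :
    (Matrix (Fin n) (Fin n) ℍ)ˣ →* (CoquaternionModel n ≃L[ℝ] CoquaternionModel n) where
  toFun A := coquaternionAct n A
  map_one' := by
    refine ContinuousLinearEquiv.ext (funext fun v ↦ ?_)
    rw [coquaternionAct_apply, Units.val_one, Matrix.one_mulVec]
    rfl
  map_mul' A B := by
    refine ContinuousLinearEquiv.ext (funext fun v ↦ ?_)
    change coquaternionAct n (A * B) v = coquaternionAct n A (coquaternionAct n B v)
    rw [coquaternionAct_apply, coquaternionAct_apply, coquaternionAct_apply,
      Matrix.mulVec_mulVec, Units.val_mul]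

/-- `GL(n, ℍ) × 1 × 1 × 1` as a group of real automorphisms of `ℍⁿ × ℝ × ℝ × ℝ`. -/
def coquaternionGL (n : ℕ) : Subgroup (CoquaternionModel n ≃L[ℝ] CoquaternionModel n) :=
  (coquaternionRep n).range

/-- `Sp(n) × 1 × 1 × 1` as a group of real automorphisms of `ℍⁿ × ℝ × ℝ × ℝ`, where `Sp(n)` is the
group of quaternionic `n × n` matrices `A` with `Aᴴ A = A Aᴴ = 1`. -/
def coquaternionSp (n : ℕ) : Subgroup (CoquaternionModel n ≃L[ℝ] CoquaternionModel n) :=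
  ((coquaternionRep n).comp (Unitary.toUnits (R := Matrix (Fin n) (Fin n) ℍ))).range

/-- A smooth local frame of the tangent bundle of `M` with model fibre `F`, on an open set `U`: linear
isomorphisms `F ≃ T_x M`, depending smoothly on `x ∈ U` (equivalently, a smooth local trivialization
of `TM` over `U`). The values of `frame` outside of `U` are irrelevant. -/
structure SmoothTangentFrame (F : Type*) [NormedAddCommGroup F] [NormedSpace ℝ F]
    (m : ℕ) (M : Type*) [TopologicalSpace M]
    [ChartedSpace (EuclideanSpace ℝ (Fin m)) M] [IsManifold (𝓡 m) ∞ M] where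
  /-- the domain -/
  U : Set M
  isOpen_U : IsOpen U
  /-- the isomorphisms from the model fibre to the tangent spaces -/
  frame : ∀ x : M, F ≃L[ℝ] TangentSpace (𝓡 m) x
  contMDiffOn_frame : ∀ v : F, ContMDiffOn (𝓡 m) (𝓡 m).tangent ∞
    (fun x ↦ (⟨x, frame x v⟩ : TangentBundle (𝓡 m) M)) U

/-- The structure group of the tangent bundle of `M` reduces to the group `G` of linear automorphisms
of the model fibre `F`: the tangent bundle has an atlas of smooth local frames (trivializations)
whose domains cover `M` and whose transition functions take their values in `G`. For a closed
subgroup `G`, the transition functions are then automatically smooth as maps into `G`. -/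
def TangentStructureGroupReducesTo {F : Type*} [NormedAddCommGroup F] [NormedSpace ℝ F]
    (G : Subgroup (F ≃L[ℝ] F)) (m : ℕ) (M : Type*) [TopologicalSpace M]
    [ChartedSpace (EuclideanSpace ℝ (Fin m)) M]
    [IsManifold (𝓡 m) ∞ M] : Prop :=
  ∃ 𝒜 : Set (SmoothTangentFrame F m M),
    (∀ x : M, ∃ e ∈ 𝒜, x ∈ e.U) ∧
    ∀ e ∈ 𝒜, ∀ e' ∈ 𝒜, ∀ x ∈ e.U ∩ e'.U, (e.frame x).trans (e'.frame x).symm ∈ G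

/-- The smooth manifold `M` is orientable: it can be covered by charts of its smooth structure all of
whose transition maps have positive Jacobian determinant. -/
def IsOrientableManifold (m : ℕ) (M : Type*) [TopologicalSpace M]
    [ChartedSpace (EuclideanSpace ℝ (Fin m)) M]
    [IsManifold (𝓡 m) ∞ M] : Prop :=
  ∃ 𝒜 ⊆ IsManifold.maximalAtlas (𝓡 m) ∞ M,
    (∀ x : M, ∃ e ∈ 𝒜, x ∈ e.source) ∧
    ∀ e ∈ 𝒜, ∀ e' ∈ 𝒜, ∀ y ∈ (e.symm.trans e').source,
      0 < (fderiv ℝ (e.symm.trans e') y).det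

end

/-! At each point the tensors make the common kernel of the `η_a` a right quaternionic vector space,
with `v·i = -φ_0 v` and so on, and `TM` splits as this kernel plus the span of the `ξ_a`. A frame
`ℍⁿ × ℝ³ ≃ T_xM` is called adapted if it carries the model structure to the given one. Two adapted
frames differ by an automorphism of the model. These automorphisms form exactly `GL(n, ℍ) × 1 × 1 ×
1`, and those that also preserve the standard scalar product form `Sp(n) × 1 × 1 × 1`
(`mem_coquaternionGL_iff`, `mem_coquaternionSp_iff`).

From structure to reduction, it remains to find smooth adapted frames near each point. Quaternionic
Gram–Schmidt (`IsLocalMetric.exists_isUnitary`) gives them once a compatible metric is available. If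
none is given, a local one suffices: the Euclidean product of a trivialization, averaged over the
`φ_a` (`isCompatible_average`).

From reduction to structure, the model tensors are transported by the frames. The result does not
depend on the frame, because the group fixes these tensors, and it is smooth because its components
in a frame are constant.

For orientability, an element of `GL(n, ℍ)` commutes with right multiplication by `i`. It is
therefore complex linear for that structure and has positive real determinant. The dimension is odd,
so a chart of the wrong sign is corrected by composing it with `-1`. -/

noncomputable section

/-! ### Linear algebra of a coquaternion structure. -/

/-- A coquaternion structure on a real vector space: the pointwise data of an almost coquaternion
structure. -/
structure CoquaternionSystem (V : Type*) [AddCommGroup V] [Module ℝ V] where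
  /-- the endomorphisms -/
  φ : Fin 3 → V →ₗ[ℝ] V
  /-- the vectors -/
  ξ : Fin 3 → V
  /-- the linear forms -/
  η : Fin 3 → V →ₗ[ℝ] ℝ
  φ_φ_self : ∀ a v, φ a (φ a v) = -v + η a v • ξ a
  η_ξ_self : ∀ a, η a (ξ a) = 1
  φ_ξ_self : ∀ a, φ a (ξ a) = 0
  η_φ_self : ∀ a v, η a (φ a v) = 0
  φ_φ_left : ∀ a v, φ a (φ (a + 1) v) = φ (a + 2) v + η (a + 1) v • ξ a
  φ_φ_right : ∀ a v, φ (a + 1) (φ a v) = -φ (a + 2) v + η a v • ξ (a + 1)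
  φ_ξ_left : ∀ a, φ a (ξ (a + 1)) = ξ (a + 2)
  φ_ξ_right : ∀ a, φ (a + 1) (ξ a) = -ξ (a + 2)
  η_φ_left : ∀ a v, η a (φ (a + 1) v) = η (a + 2) v
  η_φ_right : ∀ a v, η (a + 1) (φ a v) = -η (a + 2) v
  η_ξ_left : ∀ a, η a (ξ (a + 1)) = 0
  η_ξ_right : ∀ a, η (a + 1) (ξ a) = 0

namespace CoquaternionSystem

variable {V : Type*} [AddCommGroup V] [Module ℝ V] (S : CoquaternionSystem V)

theorem φ_φ_zero_one (v : V) : S.φ 0 (S.φ 1 v) = S.φ 2 v + S.η 1 v • S.ξ 0 := S.φ_φ_left 0 v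
theorem φ_φ_one_two (v : V) : S.φ 1 (S.φ 2 v) = S.φ 0 v + S.η 2 v • S.ξ 1 := S.φ_φ_left 1 v
theorem φ_φ_two_zero (v : V) : S.φ 2 (S.φ 0 v) = S.φ 1 v + S.η 0 v • S.ξ 2 := S.φ_φ_left 2 v
theorem φ_φ_one_zero (v : V) : S.φ 1 (S.φ 0 v) = -S.φ 2 v + S.η 0 v • S.ξ 1 := S.φ_φ_right 0 v
theorem φ_φ_two_one (v : V) : S.φ 2 (S.φ 1 v) = -S.φ 0 v + S.η 1 v • S.ξ 2 := S.φ_φ_right 1 v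
theorem φ_φ_zero_two (v : V) : S.φ 0 (S.φ 2 v) = -S.φ 1 v + S.η 2 v • S.ξ 0 := S.φ_φ_right 2 v

theorem φ_ξ_zero_one : S.φ 0 (S.ξ 1) = S.ξ 2 := S.φ_ξ_left 0
theorem φ_ξ_one_two : S.φ 1 (S.ξ 2) = S.ξ 0 := S.φ_ξ_left 1
theorem φ_ξ_two_zero : S.φ 2 (S.ξ 0) = S.ξ 1 := S.φ_ξ_left 2
theorem φ_ξ_one_zero : S.φ 1 (S.ξ 0) = -S.ξ 2 := S.φ_ξ_right 0
theorem φ_ξ_two_one : S.φ 2 (S.ξ 1) = -S.ξ 0 := S.φ_ξ_right 1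
theorem φ_ξ_zero_two : S.φ 0 (S.ξ 2) = -S.ξ 1 := S.φ_ξ_right 2

theorem η_φ_zero_one (v : V) : S.η 0 (S.φ 1 v) = S.η 2 v := S.η_φ_left 0 v
theorem η_φ_one_two (v : V) : S.η 1 (S.φ 2 v) = S.η 0 v := S.η_φ_left 1 v
theorem η_φ_two_zero (v : V) : S.η 2 (S.φ 0 v) = S.η 1 v := S.η_φ_left 2 v
theorem η_φ_one_zero (v : V) : S.η 1 (S.φ 0 v) = -S.η 2 v := S.η_φ_right 0 v
theorem η_φ_two_one (v : V) : S.η 2 (S.φ 1 v) = -S.η 0 v := S.η_φ_right 1 v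
theorem η_φ_zero_two (v : V) : S.η 0 (S.φ 2 v) = -S.η 1 v := S.η_φ_right 2 v

theorem η_ξ_zero_one : S.η 0 (S.ξ 1) = 0 := S.η_ξ_left 0
theorem η_ξ_one_two : S.η 1 (S.ξ 2) = 0 := S.η_ξ_left 1
theorem η_ξ_two_zero : S.η 2 (S.ξ 0) = 0 := S.η_ξ_left 2
theorem η_ξ_one_zero : S.η 1 (S.ξ 0) = 0 := S.η_ξ_right 0
theorem η_ξ_two_one : S.η 2 (S.ξ 1) = 0 := S.η_ξ_right 1
theorem η_ξ_zero_two : S.η 0 (S.ξ 2) = 0 := S.η_ξ_right 2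

attribute [simp] φ_φ_self η_ξ_self φ_ξ_self η_φ_self φ_φ_zero_one φ_φ_one_two φ_φ_two_zero
  φ_φ_one_zero φ_φ_two_one φ_φ_zero_two φ_ξ_zero_one φ_ξ_one_two φ_ξ_two_zero
  φ_ξ_one_zero φ_ξ_two_one φ_ξ_zero_two η_φ_zero_one η_φ_one_two η_φ_two_zero
  η_φ_one_zero η_φ_two_one η_φ_zero_two η_ξ_zero_one η_ξ_one_two η_ξ_two_zero
  η_ξ_one_zero η_ξ_two_one η_ξ_zero_two

theorem η_ξ (a b : Fin 3) : S.η a (S.ξ b) = if a = b then 1 else 0 := by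
  fin_cases a <;> fin_cases b <;> simp

/-- The common kernel of the three forms `η_a`, on which the `φ_a` define a quaternionic
structure. -/
def IsHorizontal (v : V) : Prop := ∀ a, S.η a v = 0

variable {S} in
-- Each `η_b ∘ φ_a` is zero or, up to sign, one of the three forms.
theorem IsHorizontal.φ {v : V} (h : S.IsHorizontal v) (a : Fin 3) : S.IsHorizontal (S.φ a v) := by
  intro b
  have h0 := h 0
  have h1 := h 1
  have h2 := h 2
  fin_cases a <;> fin_cases b <;> simp [h0, h1, h2]

/-- The scalar multiplication by quaternions defined by the endomorphisms `-φ_a`; on horizontal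
vectors it is a right action of the quaternion algebra. -/
def act (q : ℍ) : V →ₗ[ℝ] V :=
  q.re • LinearMap.id - q.imI • S.φ 0 - q.imJ • S.φ 1 - q.imK • S.φ 2

theorem act_apply (q : ℍ) (v : V) :
    S.act q v = q.re • v - q.imI • S.φ 0 v - q.imJ • S.φ 1 v - q.imK • S.φ 2 v := rfl

theorem act_add (q r : ℍ) (v : V) : S.act (q + r) v = S.act q v + S.act r v := by
  simp only [act_apply, Quaternion.re_add, Quaternion.imI_add, Quaternion.imJ_add,
    Quaternion.imK_add]
  module

theorem act_smul (c : ℝ) (q : ℍ) (v : V) : S.act (c • q) v = c • S.act q v := by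
  simp only [act_apply, Quaternion.re_smul, Quaternion.imI_smul, Quaternion.imJ_smul,
    Quaternion.imK_smul, smul_eq_mul]
  module

variable {S} in
theorem IsHorizontal.act {v : V} (h : S.IsHorizontal v) (q : ℍ) : S.IsHorizontal (S.act q v) := by
  intro b
  simp [act_apply, h b, h.φ _ b]

end CoquaternionSystem

/-! ### The model `ℍⁿ × ℝ³` and adapted maps. -/

/-- The quaternion units `i, j, k`. -/
def quaternionUnit : Fin 3 → ℍ := ![⟨0, 1, 0, 0⟩, ⟨0, 0, 1, 0⟩, ⟨0, 0, 0, 1⟩]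

/-- Right multiplication by the conjugate of a quaternion unit. -/
def mulRightUnit (a : Fin 3) : ℍ →ₗ[ℝ] ℍ where
  toFun q := -(q * quaternionUnit a)
  map_add' q r := by rw [add_mul, neg_add]
  map_smul' c q := by rw [smul_mul_assoc, RingHom.id_apply, smul_neg]

theorem mulRightUnit_apply (a : Fin 3) (q : ℍ) : mulRightUnit a q = -(q * quaternionUnit a) := rfl

theorem mulRightUnit_zero (q : ℍ) :
    (mulRightUnit 0 q).re = q.imI ∧
      (mulRightUnit 0 q).imI = -q.re ∧
      (mulRightUnit 0 q).imJ = -q.imK ∧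
      (mulRightUnit 0 q).imK = q.imJ := by
  simp only [mulRightUnit_apply, Quaternion.re_neg, Quaternion.imI_neg, Quaternion.imJ_neg,
    Quaternion.imK_neg, Quaternion.re_mul, Quaternion.imI_mul, Quaternion.imJ_mul,
    Quaternion.imK_mul]
  simp [quaternionUnit]

theorem mulRightUnit_one (q : ℍ) :
    (mulRightUnit 1 q).re = q.imJ ∧
      (mulRightUnit 1 q).imI = q.imK ∧
      (mulRightUnit 1 q).imJ = -q.re ∧
      (mulRightUnit 1 q).imK = -q.imI := by
  simp only [mulRightUnit_apply, Quaternion.re_neg, Quaternion.imI_neg, Quaternion.imJ_neg,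
    Quaternion.imK_neg, Quaternion.re_mul, Quaternion.imI_mul, Quaternion.imJ_mul,
    Quaternion.imK_mul]
  simp [quaternionUnit]

theorem mulRightUnit_two (q : ℍ) :
    (mulRightUnit 2 q).re = q.imK ∧
      (mulRightUnit 2 q).imI = -q.imJ ∧
      (mulRightUnit 2 q).imJ = q.imI ∧
      (mulRightUnit 2 q).imK = -q.re := by
  simp only [mulRightUnit_apply, Quaternion.re_neg, Quaternion.imI_neg, Quaternion.imJ_neg,
    Quaternion.imK_neg, Quaternion.re_mul, Quaternion.imI_mul, Quaternion.imJ_mul,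
    Quaternion.imK_mul]
  simp [quaternionUnit]

namespace CoquaternionSystem

variable {V : Type*} [AddCommGroup V] [Module ℝ V] (S : CoquaternionSystem V)

variable {S} in
-- On horizontal vectors the terms in `ξ` disappear and the `φ_a` satisfy the quaternion relations.
-- The minus sign in `act` reverses the order of products: `(v·i)·j = φ_1 φ_0 v = -φ_2 v = v·k`.
theorem IsHorizontal.φ_act {v : V} (h : S.IsHorizontal v) (a : Fin 3) (q : ℍ) :
    S.φ a (S.act q v) = S.act (mulRightUnit a q) v := by
  have h0 := h 0
  have h1 := h 1
  have h2 := h 2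
  fin_cases a <;> simp [mulRightUnit_zero, mulRightUnit_one,
    mulRightUnit_two, act_apply, h0, h1, h2] <;> module

/-- The standard coquaternion structure of `ℍⁿ × ℝ³`. -/
def model (n : ℕ) : CoquaternionSystem (CoquaternionModel n) where
  φ a := LinearMap.prodMap
    (LinearMap.pi fun i ↦ mulRightUnit a ∘ₗ LinearMap.proj i)
    -- On the span of the `ξ_b` the relations force `φ_a` to be the cross product with the basis
    -- vector `e_a`.
    (crossProduct (Pi.single a 1))
  ξ a := (0, Pi.single a 1)
  η a := LinearMap.proj a ∘ₗ LinearMap.snd ℝ _ _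
  φ_φ_self a v := by
    refine Prod.ext (funext fun i ↦ ?_) (funext fun b ↦ ?_)
    · fin_cases a <;> ext <;> simp [mulRightUnit_zero,
        mulRightUnit_one, mulRightUnit_two]
    · fin_cases a <;> fin_cases b <;> simp [crossProduct]
  η_ξ_self a := by simp
  φ_ξ_self a := by
    refine Prod.ext (funext fun i ↦ ?_) (funext fun b ↦ ?_)
    · simp
    · simp
  η_φ_self a v := by fin_cases a <;> simp [crossProduct]
  φ_φ_left a v := by
    refine Prod.ext (funext fun i ↦ ?_) (funext fun b ↦ ?_)
    · fin_cases a <;> ext <;> simp [mulRightUnit_zero,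
        mulRightUnit_one, mulRightUnit_two]
    · fin_cases a <;> fin_cases b <;> simp [crossProduct, Matrix.vecHead, Matrix.vecTail]
  φ_φ_right a v := by
    refine Prod.ext (funext fun i ↦ ?_) (funext fun b ↦ ?_)
    · fin_cases a <;> ext <;> simp [mulRightUnit_zero,
        mulRightUnit_one, mulRightUnit_two]
    · fin_cases a <;> fin_cases b <;> simp [crossProduct, Matrix.vecHead, Matrix.vecTail]
  φ_ξ_left a := by
    refine Prod.ext (funext fun i ↦ ?_) (funext fun b ↦ ?_)
    · simp
    · fin_cases a <;> fin_cases b <;> simp [crossProduct]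
  φ_ξ_right a := by
    refine Prod.ext (funext fun i ↦ ?_) (funext fun b ↦ ?_)
    · simp
    · fin_cases a <;> fin_cases b <;> simp [crossProduct]
  η_φ_left a v := by fin_cases a <;> simp [crossProduct]
  η_φ_right a v := by fin_cases a <;> simp [crossProduct]
  η_ξ_left a := by fin_cases a <;> simp
  η_ξ_right a := by fin_cases a <;> simp

theorem model_φ_apply (n : ℕ) (a : Fin 3) (p : CoquaternionModel n) :
    (model n).φ a p =
      (fun i ↦ mulRightUnit a (p.1 i), crossProduct (Pi.single a (1 : ℝ)) p.2) := rfl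

theorem model_ξ (n : ℕ) (a : Fin 3) : (model n).ξ a = (0, Pi.single a 1) := rfl

theorem model_η_apply (n : ℕ) (a : Fin 3) (p : CoquaternionModel n) : (model n).η a p = p.2 a := rfl

/-- The map `ℍⁿ × ℝ³ → V`, `(q, t) ↦ ∑ w_i q_i + ∑ t_a ξ_a`. -/
def frameMap {n : ℕ} (w : Fin n → V) : CoquaternionModel n →ₗ[ℝ] V where
  toFun p := ∑ i, S.act (p.1 i) (w i) + ∑ a, p.2 a • S.ξ a
  map_add' p q := by
    simp only [Prod.fst_add, Prod.snd_add, Pi.add_apply, act_add, add_smul,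
      Finset.sum_add_distrib]
    abel
  map_smul' c p := by
    simp only [Prod.smul_fst, Prod.smul_snd, Pi.smul_apply, act_smul, smul_eq_mul, mul_smul,
      Finset.smul_sum, smul_add, RingHom.id_apply]

theorem frameMap_apply {n : ℕ} (w : Fin n → V) (p : CoquaternionModel n) :
    S.frameMap w p = ∑ i, S.act (p.1 i) (w i) + ∑ a, p.2 a • S.ξ a := rfl

/-- A linear map from the model respects the coquaternion structures. -/
structure IsAdapted {n : ℕ} (f : CoquaternionModel n → V) : Prop where
  map_φ : ∀ a p, f ((model n).φ a p) = S.φ a (f p)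
  map_ξ : ∀ a, f ((model n).ξ a) = S.ξ a
  η_map : ∀ a p, S.η a (f p) = (model n).η a p

theorem isAdapted_frameMap {n : ℕ} {w : Fin n → V} (hw : ∀ i, S.IsHorizontal (w i)) :
    S.IsAdapted (S.frameMap w) where
  map_φ a p := by
    simp only [frameMap_apply, model_φ_apply, map_add, map_sum, (hw _).φ_act, add_right_inj]
    fin_cases a <;> simp [Fin.sum_univ_three, crossProduct] <;> module
  map_ξ a := by simp [frameMap_apply, model_ξ, act_apply, Pi.single_apply]
  η_map a p := by
    simp [frameMap_apply, model_η_apply, ((hw _).act _) a, η_ξ]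

/-! ### Compatible scalar products and unitary systems. -/

/-- A scalar product compatible with a coquaternion structure. -/
structure IsCompatible (B : V →ₗ[ℝ] V →ₗ[ℝ] ℝ) : Prop where
  symm : ∀ v w, B v w = B w v
  pos : ∀ v, v ≠ 0 → 0 < B v v
  η_eq : ∀ a v, S.η a v = B (S.ξ a) v
  map_φ_φ : ∀ a v w, B (S.φ a v) (S.φ a w) = B v w - S.η a v * S.η a w

/-- `w` is orthonormal for the quaternionic Hermitian form defined by `B`. -/
def IsUnitary (B : V →ₗ[ℝ] V →ₗ[ℝ] ℝ)
    {k : ℕ} (w : Fin k → V) : Prop :=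
  (∀ i, S.IsHorizontal (w i)) ∧ (∀ i j, B (w i) (w j) = if i = j then 1 else 0) ∧
    ∀ i j a, B (w i) (S.φ a (w j)) = 0

namespace IsCompatible

variable {S : CoquaternionSystem V} {B : V →ₗ[ℝ] V →ₗ[ℝ] ℝ}

/-- Compatibility is applied to `v` and `φ_a w`. The correction terms vanish because `η_a ∘ φ_a =
0`. -/
theorem φ_left (hB : S.IsCompatible B) (a : Fin 3) (v w : V) : B (S.φ a v) w = -B v (S.φ a w) := by
  have h := hB.map_φ_φ a v (S.φ a w)
  rw [S.φ_φ_self, map_add, map_smul, map_neg, hB.symm (S.φ a v) (S.ξ a), ← hB.η_eq,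
    S.η_φ_self, S.η_φ_self] at h
  simp at h
  linarith

/-- Skewness moves every `φ_a` onto `w`. There the mixed products reduce to `± φ_c w`, which is
orthogonal to `u`, so only the four diagonal terms survive. -/
theorem act_act (hB : S.IsCompatible B) {u w : V} (hw : S.IsHorizontal w) {c : ℝ} (h : B u w = c)
    (hφ : ∀ a, B u (S.φ a w) = 0) (p q : ℍ) :
    B (S.act p u) (S.act q w) = c * inner ℝ p q := by
  have h0 := hw 0
  have h1 := hw 1
  have h2 := hw 2
  simp [act_apply, hB.φ_left, h0, h1, h2, h, hφ, Quaternion.inner_def]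
  ring

end IsCompatible

/-- The standard scalar product of `ℍⁿ × ℝ³`. -/
def modelInner (n : ℕ) : CoquaternionModel n →ₗ[ℝ] CoquaternionModel n →ₗ[ℝ] ℝ :=
  LinearMap.mk₂ ℝ (fun p q ↦ ∑ i, inner ℝ (p.1 i) (q.1 i) + ∑ a, p.2 a * q.2 a)
    (fun p p' q ↦ by
      simp only [Prod.fst_add, Prod.snd_add, Pi.add_apply, inner_add_left, add_mul,
        Finset.sum_add_distrib]
      ring)
    (fun c p q ↦ by
      simp [real_inner_smul_left, mul_assoc, Finset.mul_sum, mul_add])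
    (fun p q q' ↦ by
      simp only [Prod.fst_add, Prod.snd_add, Pi.add_apply, inner_add_right, mul_add,
        Finset.sum_add_distrib]
      ring)
    (fun c p q ↦ by
      simp [real_inner_smul_right, mul_left_comm, Finset.mul_sum, mul_add])

theorem modelInner_apply (n : ℕ) (p q : CoquaternionModel n) :
    modelInner n p q = ∑ i, inner ℝ (p.1 i) (q.1 i) + ∑ a, p.2 a * q.2 a := rfl

theorem modelInner_self_pos (n : ℕ) {p : CoquaternionModel n} (hp : p ≠ 0) :
    0 < modelInner n p p := by
  have h1 : 0 ≤ ∑ i, inner ℝ (p.1 i) (p.1 i) := Finset.sum_nonneg fun i _ ↦ real_inner_self_nonneg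
  have h2 : 0 ≤ ∑ a, p.2 a * p.2 a := Finset.sum_nonneg fun i _ ↦ mul_self_nonneg _
  rw [modelInner_apply]
  refine lt_of_le_of_ne (add_nonneg h1 h2) fun h ↦ hp ?_
  have h1' : ∑ i, inner ℝ (p.1 i) (p.1 i) = 0 := by linarith
  have h2' : ∑ a, p.2 a * p.2 a = 0 := by linarith
  rw [Finset.sum_eq_zero_iff_of_nonneg fun i _ ↦ real_inner_self_nonneg] at h1'
  rw [Finset.sum_eq_zero_iff_of_nonneg fun i _ ↦ mul_self_nonneg _] at h2'
  refine Prod.ext (funext fun i ↦ ?_) (funext fun a ↦ ?_)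
  · simpa using h1' i
  · simpa using h2' a

theorem isCompatible_model (n : ℕ) : (model n).IsCompatible (modelInner n) where
  symm p q := by simp only [modelInner_apply, real_inner_comm, mul_comm]
  pos p hp := modelInner_self_pos n hp
  η_eq a p := by simp [modelInner_apply, model_η_apply, model_ξ, Pi.single_apply]
  map_φ_φ a p q := by
    simp only [modelInner_apply, model_φ_apply, model_η_apply]
    have h : ∀ x y : ℍ, inner ℝ (mulRightUnit a x) (mulRightUnit a y) = inner ℝ x y := by
      intro x y
      fin_cases a <;> simp [Quaternion.inner_def, mulRightUnit_zero,
        mulRightUnit_one, mulRightUnit_two] <;> ring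
    simp only [h, add_sub_assoc, add_right_inj]
    fin_cases a <;> simp [Fin.sum_univ_three, crossProduct] <;> ring

/-- The quaternionic lines of the `w_i` are mutually orthogonal by `act_act`. The `ξ_a` are
orthonormal and orthogonal to horizontal vectors, since `B (ξ_a) = η_a`. -/
theorem IsUnitary.map_frameMap {S : CoquaternionSystem V} {B : V →ₗ[ℝ] V →ₗ[ℝ] ℝ}
    (hB : S.IsCompatible B) {n : ℕ} {w : Fin n → V} (hw : S.IsUnitary B w)
    (p q : CoquaternionModel n) :
    B (S.frameMap w p) (S.frameMap w q) = modelInner n p q := by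
  have h1 : ∀ i j, B (S.act (p.1 i) (w i)) (S.act (q.1 j) (w j)) =
      if i = j then inner ℝ (p.1 i) (q.1 j) else 0 := fun i j ↦ by
    rw [hB.act_act (hw.1 j) (hw.2.1 i j) (hw.2.2 i j)]
    simp
  have h2 : ∀ a i r, S.η a (S.act r (w i)) = 0 := fun a i r ↦ ((hw.1 i).act r) a
  have h3 : ∀ a i r, B (S.act r (w i)) (S.ξ a) = 0 := fun a i r ↦ by
    rw [hB.symm, ← hB.η_eq, h2]
  simp [frameMap_apply, h1, h2, h3, ← hB.η_eq, η_ξ, modelInner_apply]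

theorem finrank_coquaternionModel (n : ℕ) :
    Module.finrank ℝ (CoquaternionModel n) = 4 * n + 3 := by
  have : Module.finrank ℝ ℍ = 4 := Quaternion.finrank_eq_four
  rw [Module.finrank_prod, Module.finrank_pi_fintype, Module.finrank_fin_fun]
  simp [this, mul_comm]

theorem IsUnitary.bijective_frameMap {S : CoquaternionSystem V} [FiniteDimensional ℝ V]
    {B : V →ₗ[ℝ] V →ₗ[ℝ] ℝ} (hB : S.IsCompatible B) {n : ℕ} {w : Fin n → V} (hw : S.IsUnitary B w)
    (hV : Module.finrank ℝ V = 4 * n + 3) :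
    Function.Bijective (S.frameMap w) := by
  have hinj : Function.Injective (S.frameMap w) := by
    rw [injective_iff_map_eq_zero]
    intro p hp
    by_contra h
    have := modelInner_self_pos n h
    rw [← hw.map_frameMap hB, hp] at this
    simp at this
  exact ⟨hinj, (LinearMap.injective_iff_surjective_of_finrank_eq_finrank
    (by rw [finrank_coquaternionModel, hV])).1 hinj⟩

end CoquaternionSystem

/-! ### The Gram–Schmidt step and averaging. -/

namespace CoquaternionSystem

variable {V : Type*} [AddCommGroup V] [Module ℝ V] (S : CoquaternionSystem V)
  (B : V →ₗ[ℝ] V →ₗ[ℝ] ℝ) {k : ℕ}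

/-- The quaternion with the given components. -/
def quaternionMk (a b c d : ℝ) : ℍ := ⟨a, b, c, d⟩

@[simp] theorem quaternionMk_re (a b c d : ℝ) : (quaternionMk a b c d).re = a := rfl
@[simp] theorem quaternionMk_imI (a b c d : ℝ) : (quaternionMk a b c d).imI = b := rfl
@[simp] theorem quaternionMk_imJ (a b c d : ℝ) : (quaternionMk a b c d).imJ = c := rfl
@[simp] theorem quaternionMk_imK (a b c d : ℝ) : (quaternionMk a b c d).imK = d := rfl

/-- The quaternionic Hermitian products of `v` with the vectors `w_i`, and the values `η_a(v)`. -/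
def coords (w : Fin k → V) : V →ₗ[ℝ] CoquaternionModel k where
  toFun v := (fun i ↦ quaternionMk (B (w i) v) (-B (S.φ 0 (w i)) v) (-B (S.φ 1 (w i)) v)
    (-B (S.φ 2 (w i)) v),
    fun a ↦ S.η a v)
  map_add' v v' := by
    refine Prod.ext (funext fun i ↦ ?_) (funext fun a ↦ ?_)
    · ext <;> simp [add_comm]
    · simp
  map_smul' c v := by
    refine Prod.ext (funext fun i ↦ ?_) (funext fun a ↦ ?_)
    · ext <;> simp
    · simp

theorem coords_apply (w : Fin k → V) (v : V) : S.coords B w v =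
    (fun i ↦ quaternionMk (B (w i) v) (-B (S.φ 0 (w i)) v) (-B (S.φ 1 (w i)) v)
    (-B (S.φ 2 (w i)) v),
      fun a ↦ S.η a v) := rfl

variable {S B}

/-- `coords` is the adjoint of `frameMap`; its minus signs are those of `act`. -/
theorem IsCompatible.frameMap_left (hB : S.IsCompatible B) (w : Fin k → V)
    (p : CoquaternionModel k) (v : V) :
    B (S.frameMap w p) v = modelInner k p (S.coords B w v) := by
  simp only [frameMap_apply, map_add, map_sum, LinearMap.add_apply, LinearMap.sum_apply,
    modelInner_apply, coords_apply, map_smul, LinearMap.smul_apply, ← hB.η_eq, smul_eq_mul,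
    act_apply, map_sub, LinearMap.sub_apply, Quaternion.inner_def]
  congr 1
  refine Finset.sum_congr rfl fun i _ ↦ ?_
  simp

/-- For unitary `w`, `frameMap` after `coords` is thus the orthogonal projection onto the
quaternionic span of the `w_i` plus the span of the `ξ_a`. -/
theorem IsUnitary.frameMap_left_sub (hB : S.IsCompatible B) {w : Fin k → V}
    (hw : S.IsUnitary B w) (p : CoquaternionModel k) (v : V) :
    B (S.frameMap w p) (v - S.frameMap w (S.coords B w v)) = 0 := by
  rw [map_sub, hw.map_frameMap hB, hB.frameMap_left, sub_self]

theorem frameMap_single (w : Fin k → V) (i : Fin k) :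
    S.frameMap w (Pi.single i 1, 0) = w i := by
  rw [frameMap_apply, Finset.sum_eq_single i]
  · simp [act_apply]
  · intro j _ hj
    simp [hj, act_apply]
  · simp

/-- The range of `frameMap` contains the `ξ_a`, the `w_i` and the `φ_a w_i`, so `h` gives
horizontality and all cross relations. `B u (φ_a u) = 0` is skewness. -/
theorem IsUnitary.cons (hB : S.IsCompatible B) {w : Fin k → V} (hw : S.IsUnitary B w) {u : V}
    (hu : B u u = 1) (h : ∀ p, B (S.frameMap w p) u = 0) :
    S.IsUnitary B (Fin.cons u w : Fin (k + 1) → V) := by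
  have hf := S.isAdapted_frameMap hw.1
  have hη : S.IsHorizontal u := fun a ↦ by rw [hB.η_eq, ← hf.map_ξ, h]
  have h1 : ∀ i, B (w i) u = 0 := fun i ↦ by rw [← frameMap_single (S := S) w i, h]
  have h2 : ∀ i a, B (S.φ a (w i)) u = 0 := fun i a ↦ by
    rw [← frameMap_single (S := S) w i, ← hf.map_φ, h]
  have h3 : ∀ a, B u (S.φ a u) = 0 := fun a ↦ by
    have := hB.φ_left a u u
    rw [hB.symm] at this
    linarith
  refine ⟨Fin.forall_fin_succ.2 ⟨by simpa using hη, by simpa using hw.1⟩,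
    Fin.forall_fin_succ.2 ⟨Fin.forall_fin_succ.2 ⟨by simpa using hu, fun i ↦ ?_⟩,
      fun i ↦ Fin.forall_fin_succ.2 ⟨?_, fun j ↦ ?_⟩⟩,
    Fin.forall_fin_succ.2 ⟨Fin.forall_fin_succ.2 ⟨by simpa using h3, fun i a ↦ ?_⟩,
      fun i ↦ Fin.forall_fin_succ.2 ⟨fun a ↦ ?_, fun j a ↦ ?_⟩⟩⟩
  · simpa [hB.symm u, Fin.succ_ne_zero, (Fin.succ_ne_zero _).symm] using h1 i
  · simpa [Fin.succ_ne_zero] using h1 i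
  · simpa using hw.2.1 i j
  · simpa [hB.symm u] using h2 i a
  · simpa using neg_eq_zero.1 ((hB.φ_left a (w i) u).symm.trans (h2 i a))
  · simpa using hw.2.2 i j a

theorem exists_coords_eq_zero [FiniteDimensional ℝ V] (w : Fin k → V) {n : ℕ} (hk : k < n)
    (hV : Module.finrank ℝ V = 4 * n + 3) : ∃ v ≠ 0, S.coords B w v = 0 := by
  have h : LinearMap.ker (S.coords B w) ≠ ⊥ := LinearMap.ker_ne_bot_of_finrank_lt (by
    rw [finrank_coquaternionModel, hV]
    omega)
  obtain ⟨v, hv, h0⟩ := (Submodule.ne_bot_iff _).1 h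
  exact ⟨v, h0, hv⟩

/-- The horizontal part of a vector. -/
def hor (S : CoquaternionSystem V) : V →ₗ[ℝ] V :=
  LinearMap.id - ∑ a, (S.η a).smulRight (S.ξ a)

theorem hor_apply (v : V) : S.hor v = v - ∑ a, S.η a v • S.ξ a := by simp [hor]

theorem hor_ξ (a : Fin 3) : S.hor (S.ξ a) = 0 := by
  simp [hor_apply, η_ξ]

theorem hor_φ (a : Fin 3) (v : V) : S.hor (S.φ a v) = S.φ a (S.hor v) := by
  fin_cases a <;> simp [hor_apply, Fin.sum_univ_three] <;> abel

theorem isHorizontal_hor (v : V) : S.IsHorizontal (S.hor v) := fun a ↦ by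
  simp [hor_apply, η_ξ]

/-- A compatible scalar product obtained from an arbitrary one by averaging. -/
def average (S : CoquaternionSystem V) (B : V →ₗ[ℝ] V →ₗ[ℝ] ℝ) : V →ₗ[ℝ] V →ₗ[ℝ] ℝ :=
  B.compl₁₂ S.hor S.hor + ∑ a, B.compl₁₂ (S.φ a ∘ₗ S.hor) (S.φ a ∘ₗ S.hor) +
    ∑ a, (S.η a).smulRight (S.η a)

theorem average_apply (v w : V) : S.average B v w = B (S.hor v) (S.hor w) +
    ∑ a, B (S.φ a (S.hor v)) (S.φ a (S.hor w)) + ∑ a, S.η a v * S.η a w := by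
  simp [average]

/-- On horizontal vectors the maps `±1, ±φ_a` form the quaternion group. Signs do not affect `B`, so
composing with `φ_a` permutes the four horizontal summands. The last sum makes the `ξ_a` orthonormal
and orthogonal to the horizontal space. -/
theorem isCompatible_average (hs : ∀ v w, B v w = B w v) (hp : ∀ v, v ≠ 0 → 0 < B v v) :
    S.IsCompatible (S.average B) where
  symm v w := by simp only [average_apply, hs (S.hor v), hs (S.φ _ (S.hor v)), mul_comm]
  pos v hv := by
    have hp' : ∀ v, 0 ≤ B v v := fun v ↦ by
      by_cases h : v = 0
      · simp [h]
      · exact (hp v h).le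
    have h1 := Finset.sum_nonneg fun a (_ : a ∈ Finset.univ) ↦ hp' (S.φ a (S.hor v))
    have h2 := Finset.sum_nonneg fun a (_ : a ∈ Finset.univ) ↦ mul_self_nonneg (S.η a v)
    rw [average_apply]
    by_contra! h
    have h0 := hp' (S.hor v)
    have h3 : S.hor v = 0 := by
      by_contra h3
      have := hp _ h3
      linarith
    have h4 : ∑ a, S.η a v * S.η a v = 0 := by linarith
    rw [Finset.sum_eq_zero_iff_of_nonneg fun i _ ↦ mul_self_nonneg _] at h4
    rw [hor_apply, Finset.sum_eq_zero, sub_zero] at h3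
    · exact hv h3
    · intro a ha
      rw [mul_self_eq_zero.1 (h4 a ha), zero_smul]
  η_eq a v := by
    simp [average_apply, hor_ξ, η_ξ]
  map_φ_φ a v w := by
    have hv := S.isHorizontal_hor v
    have hw := S.isHorizontal_hor w
    simp only [average_apply, hor_φ]
    generalize S.hor v = v' at *
    generalize S.hor w = w' at *
    have h0 := hv 0
    have h1 := hv 1
    have h2 := hv 2
    have h0' := hw 0
    have h1' := hw 1
    have h2' := hw 2
    fin_cases a <;> simp [Fin.sum_univ_three, h0, h1, h2, h0', h1', h2'] <;> ring

end CoquaternionSystem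

/-! ### The automorphisms of the model and their determinants. -/

namespace CoquaternionSystem

variable {V : Type*} [AddCommGroup V] [Module ℝ V] {S : CoquaternionSystem V} {n : ℕ}

/-- The standard quaternionic basis vectors of the model. -/
def modelBasis (n : ℕ) (j : Fin n) : CoquaternionModel n := (Pi.single j 1, 0)

theorem act_model_fst (q : ℍ) (p : CoquaternionModel n) (i : Fin n) :
    ((model n).act q p).1 i = p.1 i * q := by
  simp only [act_apply, Prod.fst_sub, Prod.smul_fst, model_φ_apply, Pi.sub_apply, Pi.smul_apply]
  ext <;> simp only [Quaternion.re_mul, Quaternion.imI_mul, Quaternion.imJ_mul, Quaternion.re_sub,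
    Quaternion.imI_sub, Quaternion.imJ_sub, Quaternion.imK_sub, Quaternion.re_smul,
    Quaternion.imI_smul, Quaternion.imJ_smul, Quaternion.imK_smul,
    Quaternion.imK_mul, mulRightUnit_zero, mulRightUnit_one, mulRightUnit_two, smul_eq_mul] <;> ring

theorem isHorizontal_modelBasis (j : Fin n) : (model n).IsHorizontal (modelBasis n j) :=
  fun _ ↦ rfl

theorem frameMap_modelBasis (p : CoquaternionModel n) :
    (model n).frameMap (modelBasis n) p = p := by
  refine Prod.ext (funext fun i ↦ ?_) (funext fun a ↦ ?_)
  · simp [frameMap_apply, Prod.fst_sum, act_model_fst, model_ξ, modelBasis, Pi.single_apply]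
  · exact ((model n).isAdapted_frameMap isHorizontal_modelBasis).η_map a p

theorem IsAdapted.map_act {f : CoquaternionModel n →ₗ[ℝ] V} (hf : S.IsAdapted f) (q : ℍ)
    (p : CoquaternionModel n) : f ((model n).act q p) = S.act q (f p) := by
  simp [act_apply, hf.map_φ]

theorem IsAdapted.eq_frameMap {f : CoquaternionModel n →ₗ[ℝ] V} (hf : S.IsAdapted f)
    (p : CoquaternionModel n) : f p = S.frameMap (fun j ↦ f (modelBasis n j)) p := by
  conv_lhs => rw [← frameMap_modelBasis p]
  simp [frameMap_apply, hf.map_act, hf.map_ξ]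

/-- An adapted map commutes with right quaternionic multiplication and fixes the `ξ_a`, so its
values on the standard basis are the columns of a matrix acting from the left. -/
theorem IsAdapted.eq_mulVec {f : CoquaternionModel n →ₗ[ℝ] CoquaternionModel n}
    (hf : (model n).IsAdapted f) (p : CoquaternionModel n) :
    f p = ((Matrix.of fun i j ↦ (f (modelBasis n j)).1 i).mulVec p.1, p.2) := by
  refine Prod.ext (funext fun i ↦ ?_) (funext fun a ↦ hf.η_map a p)
  rw [hf.eq_frameMap]
  simp [frameMap_apply, Prod.fst_sum, act_model_fst, model_ξ, Matrix.mulVec, dotProduct]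

theorem isAdapted_coquaternionAct (A : (Matrix (Fin n) (Fin n) ℍ)ˣ) :
    (model n).IsAdapted (coquaternionAct n A) where
  map_φ a p := by
    refine Prod.ext (funext fun i ↦ ?_) rfl
    simp [coquaternionAct_apply, model_φ_apply, Matrix.mulVec, dotProduct, mulRightUnit_apply,
      mul_assoc]
  map_ξ a := by simp [coquaternionAct_apply, model_ξ]
  η_map a p := rfl

theorem IsAdapted.symm_comp {f g : CoquaternionModel n ≃ₗ[ℝ] V} (hf : S.IsAdapted f)
    (hg : S.IsAdapted g) : (model n).IsAdapted (f.trans g.symm) where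
  map_φ a p := by
    rw [LinearEquiv.trans_apply, hf.map_φ, LinearEquiv.symm_apply_eq, hg.map_φ]
    simp
  map_ξ a := by rw [LinearEquiv.trans_apply, hf.map_ξ, LinearEquiv.symm_apply_eq, hg.map_ξ]
  η_map a p := by
    rw [← hg.η_map, LinearEquiv.trans_apply, LinearEquiv.apply_symm_apply, hf.η_map]

theorem mem_coquaternionGL_iff {T : CoquaternionModel n ≃L[ℝ] CoquaternionModel n} :
    T ∈ coquaternionGL n ↔ (model n).IsAdapted T := by
  constructor
  · rintro ⟨A, rfl⟩
    exact isAdapted_coquaternionAct A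
  · intro hT
    have hid : (model n).IsAdapted (LinearEquiv.refl ℝ (CoquaternionModel n)) :=
      ⟨fun _ _ ↦ rfl, fun _ ↦ rfl, fun _ _ ↦ rfl⟩
    -- The inverse map is adapted too, and its matrix inverts that of `T`.
    have hT' : (model n).IsAdapted T.toLinearEquiv.symm :=
      IsAdapted.symm_comp hid (g := T.toLinearEquiv) hT
    have h1 := IsAdapted.eq_mulVec (f := T.toLinearEquiv.toLinearMap) hT
    have h2 := IsAdapted.eq_mulVec (f := T.toLinearEquiv.symm.toLinearMap) hT'
    let A : Matrix (Fin n) (Fin n) ℍ := Matrix.of fun i j ↦ (T (modelBasis n j)).1 i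
    let A' : Matrix (Fin n) (Fin n) ℍ := Matrix.of fun i j ↦ (T.symm (modelBasis n j)).1 i
    have h1' : ∀ p, T p = (A.mulVec p.1, p.2) := h1
    have h2' : ∀ p, T.symm p = (A'.mulVec p.1, p.2) := h2
    refine ⟨⟨A, A', Matrix.ext_of_mulVec_single fun i ↦ ?_, Matrix.ext_of_mulVec_single fun i ↦ ?_⟩,
      ContinuousLinearEquiv.ext (funext fun p ↦ (h1' p).symm)⟩
    · have h := T.apply_symm_apply (modelBasis n i)
      rw [h1', h2', Matrix.mulVec_mulVec] at h
      rw [Matrix.one_mulVec]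
      exact congrArg Prod.fst h
    · have h := T.symm_apply_apply (modelBasis n i)
      rw [h2', h1', Matrix.mulVec_mulVec] at h
      rw [Matrix.one_mulVec]
      exact congrArg Prod.fst h

theorem inner_mul_left_quaternion (a b c : ℍ) : inner ℝ (a * b) c = inner ℝ b (star a * c) := by
  simp [Quaternion.inner_def]
  ring

theorem sum_inner_mulVec (A : Matrix (Fin n) (Fin n) ℍ) (q r : Fin n → ℍ) :
    ∑ i, inner ℝ (A.mulVec q i) (r i) = ∑ i, inner ℝ (q i) (A.conjTranspose.mulVec r i) := by
  simp only [Matrix.mulVec, dotProduct, sum_inner, inner_sum, Matrix.conjTranspose_apply,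
    inner_mul_left_quaternion]
  exact Finset.sum_comm

theorem mem_coquaternionSp_iff {T : CoquaternionModel n ≃L[ℝ] CoquaternionModel n} :
    T ∈ coquaternionSp n ↔ (model n).IsAdapted T ∧
      ∀ p q, modelInner n (T p) (T q) = modelInner n p q := by
  constructor
  · rintro ⟨A, rfl⟩
    refine ⟨isAdapted_coquaternionAct _, fun p q ↦ ?_⟩
    have hA : (A : Matrix (Fin n) (Fin n) ℍ).conjTranspose * A = 1 := A.2.1
    change modelInner n ((A : Matrix (Fin n) (Fin n) ℍ).mulVec p.1, p.2)
      ((A : Matrix (Fin n) (Fin n) ℍ).mulVec q.1, q.2) = _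
    simp only [modelInner_apply, sum_inner_mulVec]
    rw [Matrix.mulVec_mulVec, hA, Matrix.one_mulVec]
  · rintro ⟨hT, hi⟩
    obtain ⟨A, rfl⟩ := mem_coquaternionGL_iff.2 hT
    have hA : A.val.conjTranspose * A.val = 1 := by
      refine Matrix.ext_of_mulVec_single fun j ↦ ?_
      rw [Matrix.one_mulVec, ← Matrix.mulVec_mulVec]
      set r : Fin n → ℍ := Pi.single j 1
      -- Invariance gives `⟨A d, A r⟩ = ⟨d, r⟩`, hence `⟨d, A* A r - r⟩ = ⟨d, d⟩ = 0`.
      set d := A.val.conjTranspose.mulVec (A.val.mulVec r) - r with hd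
      have h := hi (d, 0) (r, 0)
      change modelInner n (A.val.mulVec d, 0) (A.val.mulVec r, 0) = _ at h
      simp only [modelInner_apply, sum_inner_mulVec, add_left_inj] at h
      have h0 : ∑ i, inner ℝ (d i) (d i) = 0 := by
        simp_rw [hd, Pi.sub_apply, inner_sub_right, Finset.sum_sub_distrib, ← Pi.sub_apply, ← hd, h,
          sub_self]
      rw [Finset.sum_eq_zero_iff_of_nonneg fun i _ ↦ real_inner_self_nonneg] at h0
      exact sub_eq_zero.1 (funext fun i ↦ inner_self_eq_zero.1 (h0 i (Finset.mem_univ i)))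
    have hA' : A.val * A.val.conjTranspose = 1 := by
      rw [left_inv_eq_right_inv hA A.val_inv]
      exact A.val_inv
    exact ⟨⟨A.val, hA, hA'⟩, by
      change coquaternionRep n _ = _
      congr 1
      exact Units.ext rfl⟩

/-- Linear automorphisms commuting with a complex structure preserve the orientation. -/
theorem _root_.LinearEquiv.det_pos_of_commute {W : Type*} [AddCommGroup W] [Module ℝ W]
    [FiniteDimensional ℝ W] (J : W →ₗ[ℝ] W) (hJ : J * J = -1) (T : W ≃ₗ[ℝ] W)
    (hT : ∀ w, T (J w) = J (T w)) : 0 < LinearMap.det (T : W →ₗ[ℝ] W) := by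
  let F : ℂ →ₐ[ℝ] Module.End ℝ W := Complex.liftAux J hJ
  -- `J` makes `W` a complex space on which `T` is complex linear; the real determinant is then the
  -- squared modulus of the complex one.
  let _ : Module ℂ W := Module.compHom W F.toRingHom
  have hsmul : ∀ (z : ℂ) (w : W), z • w = z.re • w + z.im • J w := fun z w ↦ by
    change F z w = _
    simp [F, Complex.liftAux_apply, Algebra.algebraMap_eq_smul_one]
  have : IsScalarTower ℝ ℂ W := ⟨fun r z w ↦ by
    rw [hsmul, hsmul]
    simp [mul_smul]⟩
  let TC : W →ₗ[ℂ] W :=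
    { toFun := T
      map_add' := map_add T
      map_smul' := fun z w ↦ by simp [hsmul, hT] }
  have : Module.Finite ℂ W := Module.Finite.of_restrictScalars_finite ℝ ℂ W
  have h : (T : W →ₗ[ℝ] W) = TC.restrictScalars ℝ := rfl
  have h0 : LinearMap.det (T : W →ₗ[ℝ] W) ≠ 0 := (LinearEquiv.isUnit_det' T).ne_zero
  rw [h, LinearMap.det_restrictScalars, Algebra.norm_complex_apply] at h0 ⊢
  exact lt_of_le_of_ne (Complex.normSq_nonneg _) h0.symm

theorem det_coquaternionGL_pos {T : CoquaternionModel n ≃L[ℝ] CoquaternionModel n}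
    (hT : T ∈ coquaternionGL n) :
    0 < LinearMap.det (T : CoquaternionModel n →ₗ[ℝ] CoquaternionModel n) := by
  obtain ⟨A, rfl⟩ := hT
  let L : (Fin n → ℍ) ≃ₗ[ℝ] (Fin n → ℍ) :=
    { toFun := fun q ↦ A.val.mulVec q
      invFun := fun q ↦ A.inv.mulVec q
      map_add' := fun q r ↦ by simp [Matrix.mulVec_add]
      map_smul' := fun c q ↦ by simp [Matrix.mulVec_smul]
      left_inv := fun q ↦ by simp [Matrix.mulVec_mulVec]
      right_inv := fun q ↦ by simp [Matrix.mulVec_mulVec] }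
  let J : (Fin n → ℍ) →ₗ[ℝ] (Fin n → ℍ) :=
    LinearMap.pi fun i ↦ mulRightUnit 0 ∘ₗ LinearMap.proj i
  have hL := LinearEquiv.det_pos_of_commute J
    (LinearMap.ext fun q ↦ funext fun i ↦ by
      ext <;> simp [J, mulRightUnit_zero]) L
    (fun q ↦ congrArg Prod.fst ((isAdapted_coquaternionAct A).map_φ 0 (q, 0)))
  have h : ((coquaternionRep n A : CoquaternionModel n ≃L[ℝ] CoquaternionModel n) :
      CoquaternionModel n →ₗ[ℝ] CoquaternionModel n) =
      (L : (Fin n → ℍ) →ₗ[ℝ] (Fin n → ℍ)).prodMap LinearMap.id := rfl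
  rw [h, LinearMap.det_prodMap, LinearMap.det_id, mul_one]
  exact hL

end CoquaternionSystem

/-! ### Smooth local vector fields. -/

section TangentSections

variable {m : ℕ} {M : Type*} [TopologicalSpace M] [ChartedSpace (EuclideanSpace ℝ (Fin m)) M]

instance finiteDimensional_tangentSpace (x : M) : FiniteDimensional ℝ (TangentSpace (𝓡 m) x) :=
  inferInstanceAs (FiniteDimensional ℝ (EuclideanSpace ℝ (Fin m)))

instance t2Space_tangentSpace (x : M) : T2Space (TangentSpace (𝓡 m) x) :=
  inferInstanceAs (T2Space (EuclideanSpace ℝ (Fin m)))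

theorem finrank_tangentSpace (x : M) : Module.finrank ℝ (TangentSpace (𝓡 m) x) = m :=
  finrank_euclideanSpace_fin (𝕜 := ℝ)

variable [IsManifold (𝓡 m) ∞ M]

/-- Smoothness of a vector field on a set. -/
def SmoothFieldOn (v : ∀ x : M, TangentSpace (𝓡 m) x) (U : Set M) : Prop :=
  ContMDiffOn (𝓡 m) (𝓡 m).tangent ∞ (fun x ↦ (⟨x, v x⟩ : TangentBundle (𝓡 m) M)) U

namespace SmoothFieldOn

variable {v w : ∀ x : M, TangentSpace (𝓡 m) x} {U V : Set M}

theorem mono (hv : SmoothFieldOn v U) (h : V ⊆ U) : SmoothFieldOn v V := ContMDiffOn.mono hv h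

theorem add (hv : SmoothFieldOn v U) (hw : SmoothFieldOn w U) :
    SmoothFieldOn (fun x ↦ v x + w x) U := ContMDiffOn.add_section hv hw

theorem sub (hv : SmoothFieldOn v U) (hw : SmoothFieldOn w U) :
    SmoothFieldOn (fun x ↦ v x - w x) U := ContMDiffOn.sub_section hv hw

theorem smul {f : M → ℝ} (hf : ContMDiffOn (𝓡 m) 𝓘(ℝ, ℝ) ∞ f U) (hv : SmoothFieldOn v U) :
    SmoothFieldOn (fun x ↦ f x • v x) U := ContMDiffOn.smul_section hf hv

theorem sum {ι : Type*} [Fintype ι] {v : ι → ∀ x : M, TangentSpace (𝓡 m) x}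
    (hv : ∀ i, SmoothFieldOn (v i) U) :
    SmoothFieldOn (fun x ↦ ∑ i, v i x) U := ContMDiffOn.sum_section fun i _ ↦ hv i

end SmoothFieldOn

theorem exists_smoothFieldOn_extend {x₀ : M} (v : TangentSpace (𝓡 m) x₀) :
    ∃ (U : Set M) (w : ∀ x : M, TangentSpace (𝓡 m) x),
      IsOpen U ∧ x₀ ∈ U ∧ SmoothFieldOn w U ∧ w x₀ = v := by
  obtain ⟨s, hs, h⟩ := FiberBundle.exists_contMDiffOn_extend (k := ∞) (𝓡 m)
    (EuclideanSpace ℝ (Fin m)) (V := fun x : M ↦ TangentSpace (𝓡 m) x) v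
  obtain ⟨U, hU, hUo, hx⟩ := mem_nhds_iff.1 hs
  exact ⟨U, _, hUo, hx, ContMDiffOn.mono h hU, by simp⟩

end TangentSections

/-! ### Smooth adapted frames from an almost coquaternion structure. -/

namespace AlmostCoquaternionStructure

variable {m : ℕ} {M : Type*} [TopologicalSpace M] [ChartedSpace (EuclideanSpace ℝ (Fin m)) M]
  [IsManifold (𝓡 m) ∞ M] (S : AlmostCoquaternionStructure m M)

/-- The coquaternion structure of a tangent space. -/
def system (x : M) : CoquaternionSystem (TangentSpace (𝓡 m) x) where
  φ a := ((S.str a).φ x).toLinearMap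
  ξ a := (S.str a).ξ x
  η a := ((S.str a).η x).toLinearMap
  φ_φ_self a v := (S.str a).φ_φ x v
  η_ξ_self a := (S.str a).η_ξ x
  φ_ξ_self a := (S.str a).φ_ξ x
  η_φ_self a v := (S.str a).η_φ x v
  φ_φ_left a v := sub_eq_iff_eq_add.1 (S.φ_φ_left a x v)
  φ_φ_right a v := by
    have h := S.φ_φ_right a x v
    change (S.str (a + 1)).φ x ((S.str a).φ x v) =
      -(S.str (a + 2)).φ x v + (S.str a).η x v • (S.str (a + 1)).ξ x
    rw [← h]
    abel
  φ_ξ_left a := S.φ_ξ_left a x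
  φ_ξ_right a := neg_eq_iff_eq_neg.1 (S.φ_ξ_right a x)
  η_φ_left a v := S.η_φ_left a x v
  η_φ_right a v := neg_eq_iff_eq_neg.1 (S.η_φ_right a x v)
  η_ξ_left a := S.η_ξ_left a x
  η_ξ_right a := S.η_ξ_right a x

variable {S}

theorem smoothFieldOn_ξ (a : Fin 3) (U : Set M) : SmoothFieldOn (fun x ↦ (S.system x).ξ a) U :=
  (S.str a).contMDiff_ξ.contMDiffOn

theorem smoothFieldOn_φ {v : ∀ x : M, TangentSpace (𝓡 m) x} {U : Set M} (hv : SmoothFieldOn v U)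
    (a : Fin 3) : SmoothFieldOn (fun x ↦ (S.system x).φ a (v x)) U :=
  ContMDiffOn.clm_bundle_apply (S.str a).contMDiff_φ.contMDiffOn hv

theorem contMDiffOn_η {v : ∀ x : M, TangentSpace (𝓡 m) x} {U : Set M} (hv : SmoothFieldOn v U)
    (a : Fin 3) : ContMDiffOn (𝓡 m) 𝓘(ℝ, ℝ) ∞ (fun x ↦ (S.system x).η a (v x)) U := by
  have h := ContMDiffOn.clm_bundle_apply (E₂ := Bundle.Trivial M ℝ)
    (S.str a).contMDiff_η.contMDiffOn hv
  intro x hx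
  exact (Bundle.contMDiffWithinAt_section.1 (h x hx))

theorem smoothFieldOn_act {v : ∀ x : M, TangentSpace (𝓡 m) x} {U : Set M}
    (hv : SmoothFieldOn v U) {a b c d : M → ℝ} (ha : ContMDiffOn (𝓡 m) 𝓘(ℝ, ℝ) ∞ a U)
    (hb : ContMDiffOn (𝓡 m) 𝓘(ℝ, ℝ) ∞ b U) (hc : ContMDiffOn (𝓡 m) 𝓘(ℝ, ℝ) ∞ c U)
    (hd : ContMDiffOn (𝓡 m) 𝓘(ℝ, ℝ) ∞ d U) :
    SmoothFieldOn (fun x ↦ (S.system x).act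
      (CoquaternionSystem.quaternionMk (a x) (b x) (c x) (d x)) (v x)) U :=
  (((hv.smul ha).sub ((smoothFieldOn_φ hv 0).smul hb)).sub ((smoothFieldOn_φ hv 1).smul hc)).sub
    ((smoothFieldOn_φ hv 2).smul hd)

theorem smoothFieldOn_hor {v : ∀ x : M, TangentSpace (𝓡 m) x} {U : Set M}
    (hv : SmoothFieldOn v U) : SmoothFieldOn (fun x ↦ (S.system x).hor (v x)) U := by
  simp only [CoquaternionSystem.hor_apply]
  exact hv.sub (SmoothFieldOn.sum fun a ↦ (smoothFieldOn_ξ a U).smul (contMDiffOn_η hv a))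

variable (S) in
/-- A field of compatible scalar products, smooth on `U`. -/
structure IsLocalMetric (g : ∀ x : M, TangentSpace (𝓡 m) x →ₗ[ℝ] TangentSpace (𝓡 m) x →ₗ[ℝ] ℝ)
    (U : Set M) : Prop where
  isCompatible : ∀ x ∈ U, (S.system x).IsCompatible (g x)
  -- Every smaller `V` is allowed because Gram–Schmidt shrinks the domain at each step.
  smooth : ∀ {V : Set M} {v w : ∀ x : M, TangentSpace (𝓡 m) x}, V ⊆ U → SmoothFieldOn v V →
    SmoothFieldOn w V → ContMDiffOn (𝓡 m) 𝓘(ℝ, ℝ) ∞ (fun x ↦ g x (v x) (w x)) V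

theorem smoothFieldOn_frameMap_coords
    {g : ∀ x : M, TangentSpace (𝓡 m) x →ₗ[ℝ] TangentSpace (𝓡 m) x →ₗ[ℝ] ℝ} {U V : Set M}
    (hg : S.IsLocalMetric g U) (hV : V ⊆ U) {k : ℕ} {w : Fin k → ∀ x : M, TangentSpace (𝓡 m) x}
    (hw : ∀ i, SmoothFieldOn (w i) V) {v : ∀ x : M, TangentSpace (𝓡 m) x}
    (hv : SmoothFieldOn v V) :
    SmoothFieldOn (fun x ↦ (S.system x).frameMap (fun i ↦ w i x)
      ((S.system x).coords (g x) (fun i ↦ w i x) (v x))) V := by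
  simp only [CoquaternionSystem.frameMap_apply, CoquaternionSystem.coords_apply]
  refine (SmoothFieldOn.sum fun i ↦ smoothFieldOn_act (hw i) (hg.smooth hV (hw i) hv) ?_ ?_ ?_).add
    (SmoothFieldOn.sum fun a ↦ (smoothFieldOn_ξ a V).smul (contMDiffOn_η hv a)) <;>
  exact (hg.smooth hV (smoothFieldOn_φ (hw i) _) hv).neg

theorem IsLocalMetric.exists_isUnitary
    {g : ∀ x : M, TangentSpace (𝓡 m) x →ₗ[ℝ] TangentSpace (𝓡 m) x →ₗ[ℝ] ℝ} {U : Set M}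
    (hg : S.IsLocalMetric g U) (hU : IsOpen U) {x₀ : M} (hx₀ : x₀ ∈ U) {n : ℕ}
    (hm : m = 4 * n + 3) : ∀ k ≤ n, ∃ (V : Set M) (w : Fin k → ∀ x : M, TangentSpace (𝓡 m) x),
      IsOpen V ∧ x₀ ∈ V ∧ V ⊆ U ∧ (∀ i, SmoothFieldOn (w i) V) ∧
      ∀ x ∈ V, (S.system x).IsUnitary (g x) (fun i ↦ w i x) := by
  intro k
  induction k with
  | zero =>
    exact fun _ ↦ ⟨U, fun i ↦ i.elim0, hU, hx₀, subset_rfl, fun i ↦ i.elim0,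
      fun x _ ↦ ⟨fun i ↦ i.elim0, fun i ↦ i.elim0, fun i ↦ i.elim0⟩⟩
  | succ k ih =>
    intro hk
    obtain ⟨V, w, hVo, hx₀V, hVU, hw, hwu⟩ := ih (by omega)
    -- `v₀` is already orthogonal to the span at `x₀`, so subtracting the projection leaves it
    -- unchanged there and `u x₀ ≠ 0`.
    obtain ⟨v₀, hv₀, hc⟩ := (S.system x₀).exists_coords_eq_zero (B := g x₀) (fun i ↦ w i x₀)
      (Nat.lt_of_succ_le hk) ((finrank_tangentSpace x₀).trans hm)
    obtain ⟨W, v, hWo, hx₀W, hv, rfl⟩ := exists_smoothFieldOn_extend v₀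
    let u : ∀ x : M, TangentSpace (𝓡 m) x := fun x ↦ v x - (S.system x).frameMap (fun i ↦ w i x)
      ((S.system x).coords (g x) (fun i ↦ w i x) (v x))
    have hu : SmoothFieldOn u (V ∩ W) := (hv.mono Set.inter_subset_right).sub
      (smoothFieldOn_frameMap_coords hg (Set.inter_subset_left.trans hVU)
        (fun i ↦ (hw i).mono Set.inter_subset_left) (hv.mono Set.inter_subset_right))
    have hN : ContMDiffOn (𝓡 m) 𝓘(ℝ, ℝ) ∞ (fun x ↦ g x (u x) (u x)) (V ∩ W) :=
      hg.smooth (Set.inter_subset_left.trans hVU) hu hu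
    have hu₀ : u x₀ = v x₀ := by simp [u, hc]
    -- Off the zeros of `u`, the normalizing factor is smooth.
    let V' : Set M := (V ∩ W) ∩ (fun x ↦ g x (u x) (u x)) ⁻¹' Set.Ioi 0
    have hV' : V' ⊆ V ∩ W := Set.inter_subset_left
    have hsqrt : ContMDiffOn (𝓡 m) 𝓘(ℝ, ℝ) ∞ (fun x ↦ (√(g x (u x) (u x)))⁻¹) V' := by
      intro x hx
      have hpos : 0 < g x (u x) (u x) := hx.2
      exact ContDiffAt.comp_contMDiffWithinAt (g := fun r : ℝ ↦ (√r)⁻¹)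
        ((Real.contDiffAt_sqrt hpos.ne').inv (Real.sqrt_ne_zero'.2 hpos)) (hN.mono hV' x hx)
    refine ⟨V', Fin.cons (fun x ↦ (√(g x (u x) (u x)))⁻¹ • u x) w,
      hN.continuousOn.isOpen_inter_preimage (hVo.inter hWo) isOpen_Ioi,
      ⟨⟨hx₀V, hx₀W⟩, ?_⟩, fun x hx ↦ hVU hx.1.1, Fin.forall_fin_succ.2 ⟨?_, fun i ↦ ?_⟩, ?_⟩
    · simpa [hu₀] using (hg.isCompatible x₀ hx₀).pos _ hv₀
    · simpa using (hu.mono hV').smul hsqrt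
    · simpa using (hw i).mono fun x hx ↦ hx.1.1
    · intro x hx
      have hpos : 0 < g x (u x) (u x) := hx.2
      have hcomp := hg.isCompatible x (hVU hx.1.1)
      have h := (hwu x hx.1.1).cons hcomp (u := (√(g x (u x) (u x)))⁻¹ • u x) (by
        simp only [map_smul, LinearMap.smul_apply, smul_eq_mul]
        rw [← mul_assoc, ← mul_inv, Real.mul_self_sqrt hpos.le, inv_mul_cancel₀ hpos.ne'])
        (fun p ↦ by
          rw [map_smul, (hwu x hx.1.1).frameMap_left_sub hcomp, smul_zero])
      convert h using 1
      funext i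
      refine Fin.cases ?_ (fun j ↦ ?_) i <;> simp

theorem IsLocalMetric.exists_frame {n : ℕ} {M : Type*} [TopologicalSpace M]
    [ChartedSpace (EuclideanSpace ℝ (Fin (4 * n + 3))) M] [IsManifold (𝓡 (4 * n + 3)) ∞ M]
    {S : AlmostCoquaternionStructure (4 * n + 3) M}
    {g : ∀ x : M, TangentSpace (𝓡 (4 * n + 3)) x →ₗ[ℝ] TangentSpace (𝓡 (4 * n + 3)) x →ₗ[ℝ] ℝ}
    {U : Set M} (hg : S.IsLocalMetric g U) (hU : IsOpen U) {x₀ : M} (hx₀ : x₀ ∈ U) :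
    ∃ e : SmoothTangentFrame (CoquaternionModel n) (4 * n + 3) M, x₀ ∈ e.U ∧
      ∀ x ∈ e.U, (S.system x).IsAdapted (e.frame x) ∧
        ∀ p q, g x (e.frame x p) (e.frame x q) = CoquaternionSystem.modelInner n p q := by
  classical
  obtain ⟨V, w, hVo, hx₀V, hVU, hw, hwu⟩ := hg.exists_isUnitary hU hx₀ rfl n le_rfl
  have hbij : ∀ x ∈ V, Function.Bijective ((S.system x).frameMap fun i ↦ w i x) := fun x hx ↦
    (hwu x hx).bijective_frameMap (hg.isCompatible x (hVU hx)) (finrank_tangentSpace x)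
  let f : ∀ x : M, CoquaternionModel n ≃L[ℝ] TangentSpace (𝓡 (4 * n + 3)) x := fun x ↦
    if hx : x ∈ V then (LinearEquiv.ofBijective _ (hbij x hx)).toContinuousLinearEquiv
    else ContinuousLinearEquiv.ofFinrankEq
      ((CoquaternionSystem.finrank_coquaternionModel n).trans (finrank_tangentSpace x).symm)
  have hf : ∀ x ∈ V, ∀ p, f x p = (S.system x).frameMap (fun i ↦ w i x) p := fun x hx p ↦ by
    simp only [f, dif_pos hx]
    rfl
  refine ⟨⟨V, hVo, f, fun p ↦ ?_⟩, hx₀V, fun x hx ↦ ⟨?_, fun p q ↦ ?_⟩⟩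
  · have h : SmoothFieldOn (fun x ↦ (S.system x).frameMap (fun i ↦ w i x) p) V := by
      simp only [CoquaternionSystem.frameMap_apply]
      exact (SmoothFieldOn.sum fun i ↦ smoothFieldOn_act (hw i) contMDiffOn_const
        contMDiffOn_const contMDiffOn_const contMDiffOn_const).add
        (SmoothFieldOn.sum fun a ↦ (smoothFieldOn_ξ a V).smul contMDiffOn_const)
    exact ContMDiffOn.congr h fun x hx ↦ by rw [hf x hx]
  · have h := (S.system x).isAdapted_frameMap (hwu x hx).1
    exact ⟨fun a p ↦ by simp only [hf x hx, h.map_φ], fun a ↦ by simp only [hf x hx, h.map_ξ],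
      fun a p ↦ by simp only [hf x hx, h.η_map]⟩
  · simp only [hf x hx]
    exact (hwu x hx).map_frameMap (hg.isCompatible x (hVU hx)) p q

-- Since frames are only needed locally, the Euclidean product of one trivialization is averaged. No
-- partition of unity enters, and `M` need not be Hausdorff or paracompact.
variable (S) in
theorem exists_isLocalMetric (x₀ : M) :
    ∃ (U : Set M) (g : ∀ x : M, TangentSpace (𝓡 m) x →ₗ[ℝ] TangentSpace (𝓡 m) x →ₗ[ℝ] ℝ),
      IsOpen U ∧ x₀ ∈ U ∧ S.IsLocalMetric g U := by
  let t := trivializationAt (EuclideanSpace ℝ (Fin m)) (fun x : M ↦ TangentSpace (𝓡 m) x) x₀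
  let L : ∀ x : M, TangentSpace (𝓡 m) x →ₗ[ℝ] EuclideanSpace ℝ (Fin m) := fun x ↦
    (t.continuousLinearMapAt ℝ x).toLinearMap
  let B : ∀ x : M, TangentSpace (𝓡 m) x →ₗ[ℝ] TangentSpace (𝓡 m) x →ₗ[ℝ] ℝ := fun x ↦
    (innerₗ (EuclideanSpace ℝ (Fin m))).compl₁₂ (L x) (L x)
  have hL : ∀ {V : Set M} {v : ∀ x : M, TangentSpace (𝓡 m) x}, V ⊆ t.baseSet →
      SmoothFieldOn v V →
      ContMDiffOn (𝓡 m) 𝓘(ℝ, EuclideanSpace ℝ (Fin m)) ∞ (fun x ↦ L x (v x)) V := by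
    intro V v hV hv x hx
    refine ((t.contMDiffWithinAt_section V (hV hx)).1 (hv x hx)).congr_of_eventuallyEq_of_mem ?_ hx
    filter_upwards [self_mem_nhdsWithin] with y hy
    simp [L, t.coe_linearMapAt_of_mem (hV hy)]
  have hB : ∀ {V : Set M} {v w : ∀ x : M, TangentSpace (𝓡 m) x}, V ⊆ t.baseSet →
      SmoothFieldOn v V → SmoothFieldOn w V →
      ContMDiffOn (𝓡 m) 𝓘(ℝ, ℝ) ∞ (fun x ↦ B x (v x) (w x)) V := by
    intro V v w hV hv hw
    exact fun x hx ↦ ContDiff.comp_contMDiffWithinAt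
      (g := fun p : EuclideanSpace ℝ (Fin m) × EuclideanSpace ℝ (Fin m) ↦ inner ℝ p.1 p.2)
      contDiff_inner ((hL hV hv x hx).prodMk_space (hL hV hw x hx))
  refine ⟨t.baseSet, fun x ↦ (S.system x).average (B x), t.open_baseSet,
    FiberBundle.mem_baseSet_trivializationAt' x₀, fun x hx ↦ ?_, fun hV hv hw ↦ ?_⟩
  · refine CoquaternionSystem.isCompatible_average (fun v w ↦ real_inner_comm (L x w) (L x v))
      fun v hv ↦ ?_
    change 0 < inner ℝ (L x v) (L x v)
    refine real_inner_self_pos.2 fun h ↦ hv ?_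
    rw [← t.symmL_continuousLinearMapAt (R := ℝ) hx v]
    change t.symmL ℝ x (L x v) = 0
    rw [h, map_zero]
  · simp only [CoquaternionSystem.average_apply]
    exact ((hB hV (smoothFieldOn_hor hv) (smoothFieldOn_hor hw)).add
      (contMDiffOn_finsetSum fun a _ ↦ hB hV (smoothFieldOn_φ (smoothFieldOn_hor hv) a)
        (smoothFieldOn_φ (smoothFieldOn_hor hw) a))).add
      (contMDiffOn_finsetSum fun a _ ↦ (contMDiffOn_η hv a).mul (contMDiffOn_η hw a))

end AlmostCoquaternionStructure

theorem AlmostCoquaternionMetricStructure.isLocalMetric {m : ℕ} {M : Type*} [TopologicalSpace M]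
    [ChartedSpace (EuclideanSpace ℝ (Fin m)) M] [IsManifold (𝓡 m) ∞ M]
    (S : AlmostCoquaternionMetricStructure m M) :
    S.toAlmostCoquaternionStructure.IsLocalMetric (fun x ↦
      LinearMap.mk₂ ℝ (fun v w ↦ S.g.inner x v w) (fun v w u ↦ by simp) (fun c v w ↦ by simp)
        (fun v w u ↦ by simp) (fun c v w ↦ by simp)) Set.univ where
  isCompatible x _ :=
    { symm := S.g.symm x
      pos := S.g.pos x
      η_eq := fun a ↦ S.η_eq a x
      map_φ_φ := fun a ↦ S.inner_φ_φ a x }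
  smooth _ hv hw := by
    have h := ContMDiffOn.clm_bundle_apply₂ (E₃ := Bundle.Trivial M ℝ)
      S.g.contMDiff.contMDiffOn hv hw
    exact fun x hx ↦ (Bundle.contMDiffWithinAt_section.1 (h x hx))

/-- The atlas consists of all adapted frames. The local metrics serve only to show that their
domains cover `M`. -/
theorem tangentStructureGroupReducesTo_coquaternionGL {n : ℕ} {M : Type*} [TopologicalSpace M]
    [ChartedSpace (EuclideanSpace ℝ (Fin (4 * n + 3))) M] [IsManifold (𝓡 (4 * n + 3)) ∞ M]
    (S : AlmostCoquaternionStructure (4 * n + 3) M) :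
    TangentStructureGroupReducesTo (coquaternionGL n) (4 * n + 3) M := by
  refine ⟨{e | ∀ x ∈ e.U, (S.system x).IsAdapted (e.frame x)}, fun x ↦ ?_,
    fun e he e' he' x hx ↦ ?_⟩
  · obtain ⟨U, g, hU, hx, hg⟩ := S.exists_isLocalMetric x
    obtain ⟨e, hxe, he⟩ := hg.exists_frame hU hx
    exact ⟨e, fun y hy ↦ (he y hy).1, hxe⟩
  · exact CoquaternionSystem.mem_coquaternionGL_iff.2
      (CoquaternionSystem.IsAdapted.symm_comp (f := (e.frame x).toLinearEquiv)
        (g := (e'.frame x).toLinearEquiv) (he x hx.1) (he' x hx.2))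

theorem tangentStructureGroupReducesTo_coquaternionSp {n : ℕ} {M : Type*} [TopologicalSpace M]
    [ChartedSpace (EuclideanSpace ℝ (Fin (4 * n + 3))) M] [IsManifold (𝓡 (4 * n + 3)) ∞ M]
    (S : AlmostCoquaternionMetricStructure (4 * n + 3) M) :
    TangentStructureGroupReducesTo (coquaternionSp n) (4 * n + 3) M := by
  refine ⟨{e | ∀ x ∈ e.U, (S.system x).IsAdapted (e.frame x) ∧ ∀ p q,
      S.g.inner x (e.frame x p) (e.frame x q) = CoquaternionSystem.modelInner n p q}, fun x ↦ ?_,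
    fun e he e' he' x hx ↦ ?_⟩
  · obtain ⟨e, hxe, he⟩ := S.isLocalMetric.exists_frame isOpen_univ (Set.mem_univ x)
    exact ⟨e, he, hxe⟩
  · refine CoquaternionSystem.mem_coquaternionSp_iff.2
      ⟨CoquaternionSystem.IsAdapted.symm_comp (f := (e.frame x).toLinearEquiv)
        (g := (e'.frame x).toLinearEquiv) (he x hx.1).1 (he' x hx.2).1, fun p q ↦ ?_⟩
    rw [← (he' x hx.2).2, ← (he x hx.1).2]
    simp

/-! ### Smoothness of tensors with constant components in a smooth frame. -/

/-- A family of continuous linear maps on a finite-dimensional space is smooth if all its values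
are. -/
theorem contMDiffAt_clm_of_apply {E H M F G : Type*} [NormedAddCommGroup E] [NormedSpace ℝ E]
    [TopologicalSpace H] {I : ModelWithCorners ℝ E H} [TopologicalSpace M] [ChartedSpace H M]
    [NormedAddCommGroup F] [NormedSpace ℝ F] [FiniteDimensional ℝ F]
    [NormedAddCommGroup G] [NormedSpace ℝ G] [FiniteDimensional ℝ G] {n : WithTop ℕ∞}
    {C : M → F →L[ℝ] G} {x : M} (h : ∀ v, ContMDiffAt I 𝓘(ℝ, G) n (fun y ↦ C y v) x) :
    ContMDiffAt I 𝓘(ℝ, F →L[ℝ] G) n C x := by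
  let b := Module.finBasis ℝ F
  let L : (Fin (Module.finrank ℝ F) → G) →ₗ[ℝ] (F →L[ℝ] G) :=
    (LinearMap.toContinuousLinearMap : (F →ₗ[ℝ] G) ≃ₗ[ℝ] (F →L[ℝ] G)).toLinearMap ∘ₗ
      (b.constr ℝ).toLinearMap
  have hC : C = fun y ↦ LinearMap.toContinuousLinearMap L (fun i ↦ C y (b i)) := by
    funext y
    refine ContinuousLinearMap.coe_injective (b.ext fun i ↦ ?_)
    simp [L]
  rw [hC]
  exact (ContinuousLinearMap.contMDiff _).contMDiffAt.comp x
    (contMDiffAt_pi_space.2 fun i ↦ h (b i))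

namespace SmoothTangentFrame

variable {F : Type*} [NormedAddCommGroup F] [NormedSpace ℝ F]
  {m : ℕ} {M : Type*} [TopologicalSpace M]
  [ChartedSpace (EuclideanSpace ℝ (Fin m)) M] [IsManifold (𝓡 m) ∞ M]
  (e : SmoothTangentFrame F m M)

/-- The frame, read in the preferred trivialization of the tangent bundle at `x₀`. -/
def coordMap (x₀ x : M) : F →L[ℝ] EuclideanSpace ℝ (Fin m) :=
  ((trivializationAt (EuclideanSpace ℝ (Fin m)) (fun x : M ↦ TangentSpace (𝓡 m) x)
    x₀).continuousLinearMapAt ℝ x).comp (e.frame x : F →L[ℝ] TangentSpace (𝓡 m) x)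

variable {e}

theorem inverse_coordMap {x₀ x : M} (hx : x ∈ (chartAt (EuclideanSpace ℝ (Fin m)) x₀).source) :
    (e.coordMap x₀ x).inverse = ((e.frame x).symm : TangentSpace (𝓡 m) x →L[ℝ] F).comp
      ((trivializationAt (EuclideanSpace ℝ (Fin m)) (fun x : M ↦ TangentSpace (𝓡 m) x)
        x₀).symmL ℝ x) := by
  let t := trivializationAt (EuclideanSpace ℝ (Fin m)) (fun x : M ↦ TangentSpace (𝓡 m) x) x₀
  have hxt : x ∈ t.baseSet := hx
  refine ContinuousLinearMap.inverse_eq (ContinuousLinearMap.ext fun v ↦ ?_)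
    (ContinuousLinearMap.ext fun v ↦ ?_)
  · change t.continuousLinearMapAt ℝ x (e.frame x ((e.frame x).symm (t.symmL ℝ x v))) = v
    rw [ContinuousLinearEquiv.apply_symm_apply, t.continuousLinearMapAt_symmL hxt]
  · change (e.frame x).symm (t.symmL ℝ x (t.continuousLinearMapAt ℝ x (e.frame x v))) = v
    rw [t.symmL_continuousLinearMapAt hxt, ContinuousLinearEquiv.symm_apply_apply]

theorem isInvertible_coordMap {x₀ x : M}
    (hx : x ∈ (chartAt (EuclideanSpace ℝ (Fin m)) x₀).source) :
    (e.coordMap x₀ x).IsInvertible := by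
  let t := trivializationAt (EuclideanSpace ℝ (Fin m)) (fun x : M ↦ TangentSpace (𝓡 m) x) x₀
  have hxt : x ∈ t.baseSet := hx
  refine ⟨(e.frame x).trans (t.continuousLinearEquivAt ℝ x hxt), ContinuousLinearMap.ext fun v ↦ ?_⟩
  change t.continuousLinearEquivAt ℝ x hxt (e.frame x v) = t.continuousLinearMapAt ℝ x (e.frame x v)
  simp [t.coe_linearMapAt_of_mem hxt]

variable [FiniteDimensional ℝ F]

theorem contMDiffAt_coordMap {x₀ x : M} (hx : x ∈ e.U)
    (hx' : x ∈ (chartAt (EuclideanSpace ℝ (Fin m)) x₀).source) :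
    ContMDiffAt (𝓡 m) 𝓘(ℝ, F →L[ℝ] EuclideanSpace ℝ (Fin m)) ∞ (e.coordMap x₀) x := by
  refine contMDiffAt_clm_of_apply fun v ↦ ?_
  let t := trivializationAt (EuclideanSpace ℝ (Fin m)) (fun x : M ↦ TangentSpace (𝓡 m) x) x₀
  have hxt : x ∈ t.baseSet := hx'
  have h : ContMDiffAt (𝓡 m) (𝓡 m).tangent ∞
      (fun x ↦ (⟨x, e.frame x v⟩ : TangentBundle (𝓡 m) M)) x :=
    (e.contMDiffOn_frame v).contMDiffAt (e.isOpen_U.mem_nhds hx)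
  refine ((t.contMDiffAt_section_iff hxt).1 h).congr_of_eventuallyEq ?_
  filter_upwards [t.open_baseSet.mem_nhds hxt] with y hy
  change t.continuousLinearMapAt ℝ y (e.frame y v) = _
  simp [t.coe_linearMapAt_of_mem hy]

/-- Inversion of operators is smooth at invertible ones. -/
theorem contMDiffAt_inverse_coordMap {x : M} (hx : x ∈ e.U) :
    ContMDiffAt (𝓡 m) 𝓘(ℝ, EuclideanSpace ℝ (Fin m) →L[ℝ] F) ∞
      (fun y ↦ (e.coordMap x y).inverse) x := by
  have : CompleteSpace F := FiniteDimensional.complete ℝ F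
  exact ContDiffAt.comp_contMDiffAt
    (isInvertible_coordMap (mem_chart_source _ x)).contDiffAt_map_inverse
    (contMDiffAt_coordMap hx (mem_chart_source _ x))

/-- With `C` the frame read in the trivialization, `φ` reads as `C A C⁻¹`. Likewise a form reads as
`A C⁻¹` and a bilinear form as `A(C⁻¹ ·, C⁻¹ ·)` in the two lemmas below. -/
theorem contMDiffAt_conj (A : F →L[ℝ] F)
    {φ : ∀ x : M, TangentSpace (𝓡 m) x →L[ℝ] TangentSpace (𝓡 m) x}
    (hφ : ∀ x ∈ e.U, ∀ v, φ x (e.frame x v) = e.frame x (A v)) {x : M} (hx : x ∈ e.U) :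
    ContMDiffAt (𝓡 m)
      ((𝓡 m).prod 𝓘(ℝ, EuclideanSpace ℝ (Fin m) →L[ℝ] EuclideanSpace ℝ (Fin m))) ∞
      (fun x ↦ Bundle.TotalSpace.mk' (EuclideanSpace ℝ (Fin m) →L[ℝ] EuclideanSpace ℝ (Fin m))
        (E := fun x : M ↦ TangentSpace (𝓡 m) x →L[ℝ] TangentSpace (𝓡 m) x) x (φ x)) x := by
  refine (contMDiffAt_hom_bundle _).2 ⟨contMDiffAt_id, ?_⟩
  refine ((contMDiffAt_coordMap hx (mem_chart_source _ x)).clm_comp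
    (contMDiffAt_const (c := A) |>.clm_comp
    (contMDiffAt_inverse_coordMap hx))).congr_of_eventuallyEq ?_
  filter_upwards [e.isOpen_U.mem_nhds hx,
    (chartAt (EuclideanSpace ℝ (Fin m)) x).open_source.mem_nhds (mem_chart_source _ x)]
    with y hy hy'
  rw [inverse_coordMap hy']
  refine ContinuousLinearMap.ext fun v ↦ ?_
  simp [ContinuousLinearMap.inCoordinates, coordMap, ← hφ y hy]

theorem contMDiffAt_form (A : F →L[ℝ] ℝ) {η : ∀ x : M, TangentSpace (𝓡 m) x →L[ℝ] ℝ}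
    (hη : ∀ x ∈ e.U, ∀ v, η x (e.frame x v) = A v) {x : M} (hx : x ∈ e.U) :
    ContMDiffAt (𝓡 m) ((𝓡 m).prod 𝓘(ℝ, EuclideanSpace ℝ (Fin m) →L[ℝ] ℝ)) ∞
      (fun x ↦ Bundle.TotalSpace.mk' (EuclideanSpace ℝ (Fin m) →L[ℝ] ℝ)
        (E := fun x : M ↦ TangentSpace (𝓡 m) x →L[ℝ] Bundle.Trivial M ℝ x) x (η x)) x := by
  refine (contMDiffAt_hom_bundle _).2 ⟨contMDiffAt_id, ?_⟩
  refine ((contMDiffAt_const (c := A)).clm_comp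
    (contMDiffAt_inverse_coordMap hx)).congr_of_eventuallyEq ?_
  filter_upwards [e.isOpen_U.mem_nhds hx,
    (chartAt (EuclideanSpace ℝ (Fin m)) x).open_source.mem_nhds (mem_chart_source _ x)]
    with y hy hy'
  rw [inverse_coordMap hy']
  refine ContinuousLinearMap.ext fun v ↦ ?_
  simp [ContinuousLinearMap.inCoordinates, ← hη y hy]

theorem contMDiffAt_bilin (A : F →L[ℝ] F →L[ℝ] ℝ)
    {g : ∀ x : M, TangentSpace (𝓡 m) x →L[ℝ] TangentSpace (𝓡 m) x →L[ℝ] ℝ}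
    (hg : ∀ x ∈ e.U, ∀ v w, g x (e.frame x v) (e.frame x w) = A v w) {x : M} (hx : x ∈ e.U) :
    ContMDiffAt (𝓡 m)
      ((𝓡 m).prod 𝓘(ℝ, EuclideanSpace ℝ (Fin m) →L[ℝ] EuclideanSpace ℝ (Fin m) →L[ℝ] ℝ)) ∞
      (fun x ↦ Bundle.TotalSpace.mk'
        (EuclideanSpace ℝ (Fin m) →L[ℝ] EuclideanSpace ℝ (Fin m) →L[ℝ] ℝ)
        (E := fun x : M ↦ TangentSpace (𝓡 m) x →L[ℝ] TangentSpace (𝓡 m) x →L[ℝ] ℝ)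
        x (g x)) x := by
  refine (contMDiffAt_hom_bundle _).2 ⟨contMDiffAt_id, ?_⟩
  have hD := contMDiffAt_inverse_coordMap hx
  have hL : ContMDiffAt (𝓡 m) 𝓘(ℝ, (F →L[ℝ] ℝ) →L[ℝ] (EuclideanSpace ℝ (Fin m) →L[ℝ] ℝ)) ∞
      (fun y ↦ (ContinuousLinearMap.compL ℝ (EuclideanSpace ℝ (Fin m)) F ℝ).flip
        (e.coordMap x y).inverse) x :=
    (ContinuousLinearMap.contMDiff _).contMDiffAt.comp x hD
  refine (hL.clm_comp ((contMDiffAt_const (c := A)).clm_comp hD)).congr_of_eventuallyEq ?_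
  filter_upwards [e.isOpen_U.mem_nhds hx,
    (chartAt (EuclideanSpace ℝ (Fin m)) x).open_source.mem_nhds (mem_chart_source _ x)]
    with y hy hy'
  refine ContinuousLinearMap.ext fun v ↦ ContinuousLinearMap.ext fun w ↦ ?_
  rw [inCoordinates_apply_eq₂ hy' hy' (Set.mem_univ _), inverse_coordMap hy']
  have h : ∀ u, (trivializationAt (EuclideanSpace ℝ (Fin m)) (fun x : M ↦ TangentSpace (𝓡 m) x)
      x).symmL ℝ y u = (trivializationAt (EuclideanSpace ℝ (Fin m))
        (fun x : M ↦ TangentSpace (𝓡 m) x) x).symm y u := fun u ↦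
    Bundle.Trivialization.symmL_apply _ hy' u
  simp [← hg y hy, h]

end SmoothTangentFrame

/-! ### From a reduction to a structure. -/

namespace CoquaternionSystem

variable {n : ℕ} {V : Type*} [AddCommGroup V] [Module ℝ V]

/-- Transport of a coquaternion structure along a linear isomorphism. -/
def map {W : Type*} [AddCommGroup W] [Module ℝ W] (S : CoquaternionSystem V) (f : V ≃ₗ[ℝ] W) :
    CoquaternionSystem W where
  φ a := f.conj (S.φ a)
  ξ a := f (S.ξ a)
  η a := S.η a ∘ₗ f.symm
  φ_φ_self a v := by simp [LinearEquiv.conj_apply]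
  η_ξ_self a := by simp
  φ_ξ_self a := by simp [LinearEquiv.conj_apply]
  η_φ_self a v := by simp [LinearEquiv.conj_apply]
  φ_φ_left a v := by simp [LinearEquiv.conj_apply, S.φ_φ_left]
  φ_φ_right a v := by simp [LinearEquiv.conj_apply, S.φ_φ_right]
  φ_ξ_left a := by simp [LinearEquiv.conj_apply, S.φ_ξ_left]
  φ_ξ_right a := by simp [LinearEquiv.conj_apply, S.φ_ξ_right]
  η_φ_left a v := by simp [LinearEquiv.conj_apply, S.η_φ_left]
  η_φ_right a v := by simp [LinearEquiv.conj_apply, S.η_φ_right]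
  η_ξ_left a := by simp [S.η_ξ_left]
  η_ξ_right a := by simp [S.η_ξ_right]

theorem isAdapted_map (f : CoquaternionModel n ≃ₗ[ℝ] V) : ((model n).map f).IsAdapted f where
  map_φ a p := by simp [map, LinearEquiv.conj_apply]
  map_ξ a := rfl
  η_map a p := by simp [map]

theorem isAdapted_map_of_trans {f g : CoquaternionModel n ≃ₗ[ℝ] V}
    (h : (model n).IsAdapted (g.trans f.symm)) : ((model n).map f).IsAdapted g := by
  have hf := isAdapted_map f
  have hg : ∀ p, g p = f (g.trans f.symm p) := fun p ↦ by simp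
  exact ⟨fun a p ↦ by rw [hg, h.map_φ, hf.map_φ, ← hg], fun a ↦ by rw [hg, h.map_ξ, hf.map_ξ],
    fun a p ↦ by rw [hg, hf.η_map, h.η_map]⟩

end CoquaternionSystem

section Reduction

variable {n : ℕ} {M : Type*} [TopologicalSpace M]
  [ChartedSpace (EuclideanSpace ℝ (Fin (4 * n + 3))) M] [IsManifold (𝓡 (4 * n + 3)) ∞ M]

open CoquaternionSystem

/-- A bilinear form on a finite-dimensional space as a continuous bilinear map. -/
def continuousBilin {V : Type*} [AddCommGroup V] [Module ℝ V] [TopologicalSpace V]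
    [IsTopologicalAddGroup V] [ContinuousSMul ℝ V] [T2Space V] [FiniteDimensional ℝ V]
    (B : V →ₗ[ℝ] V →ₗ[ℝ] ℝ) : V →L[ℝ] V →L[ℝ] ℝ :=
  LinearMap.toContinuousLinearMap
    ((LinearMap.toContinuousLinearMap : (V →ₗ[ℝ] ℝ) ≃ₗ[ℝ] (V →L[ℝ] ℝ)).toLinearMap ∘ₗ B)

/-- The almost coquaternion structure for which all the frames of an atlas are adapted. -/
theorem exists_almostCoquaternionStructure_of_frames
    {𝒜 : Set (SmoothTangentFrame (CoquaternionModel n) (4 * n + 3) M)}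
    (hcov : ∀ x : M, ∃ e ∈ 𝒜, x ∈ e.U)
    (htrans : ∀ e ∈ 𝒜, ∀ e' ∈ 𝒜, ∀ x ∈ e.U ∩ e'.U,
      (e.frame x).trans (e'.frame x).symm ∈ coquaternionGL n) :
    ∃ S : AlmostCoquaternionStructure (4 * n + 3) M,
      ∀ e ∈ 𝒜, ∀ x ∈ e.U, (S.system x).IsAdapted (e.frame x) := by
  choose c hc hxc using hcov
  let T : ∀ x : M, CoquaternionSystem (TangentSpace (𝓡 (4 * n + 3)) x) := fun x ↦
    (model n).map ((c x).frame x).toLinearEquiv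
  -- The chosen frame `c x` jumps with `x`, but the transported structure is adapted to every frame
  -- of the atlas. Near `x` it can thus be read in the single frame `c x`, where its components are
  -- constant.
  have hT : ∀ e ∈ 𝒜, ∀ x ∈ e.U, (T x).IsAdapted (e.frame x) := fun e he x hx ↦
    isAdapted_map_of_trans (f := ((c x).frame x).toLinearEquiv) (g := (e.frame x).toLinearEquiv)
      (mem_coquaternionGL_iff.1 (htrans e he (c x) (hc x) x ⟨hx, hxc x⟩))
  let s : Fin 3 → AlmostCocomplexStructure (4 * n + 3) M := fun a ↦
    { φ := fun x ↦ LinearMap.toContinuousLinearMap ((T x).φ a)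
      ξ := fun x ↦ (T x).ξ a
      η := fun x ↦ LinearMap.toContinuousLinearMap ((T x).η a)
      contMDiff_φ := fun x ↦ SmoothTangentFrame.contMDiffAt_conj
        (e := c x) (LinearMap.toContinuousLinearMap ((model n).φ a))
        (fun y hy v ↦ ((hT (c x) (hc x) y hy).map_φ a v).symm) (hxc x)
      contMDiff_ξ := fun x ↦ by
        refine (((c x).contMDiffOn_frame ((model n).ξ a)).contMDiffAt
          ((c x).isOpen_U.mem_nhds (hxc x))).congr_of_eventuallyEq ?_
        filter_upwards [(c x).isOpen_U.mem_nhds (hxc x)] with y hy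
        rw [(hT (c x) (hc x) y hy).map_ξ]
      contMDiff_η := fun x ↦ SmoothTangentFrame.contMDiffAt_form
        (e := c x) (LinearMap.toContinuousLinearMap ((model n).η a))
        (fun y hy v ↦ (hT (c x) (hc x) y hy).η_map a v) (hxc x)
      φ_φ := fun x v ↦ (T x).φ_φ_self a v
      η_ξ := fun x ↦ (T x).η_ξ_self a
      φ_ξ := fun x ↦ (T x).φ_ξ_self a
      η_φ := fun x v ↦ (T x).η_φ_self a v }
  let S : AlmostCoquaternionStructure (4 * n + 3) M :=
    { str := s
      φ_φ_left := fun a x v ↦ sub_eq_iff_eq_add.2 ((T x).φ_φ_left a v)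
      φ_φ_right := fun a x v ↦ by
        have h := (T x).φ_φ_right a v
        change -(T x).φ (a + 1) ((T x).φ a v) + (T x).η a v • (T x).ξ (a + 1) = (T x).φ (a + 2) v
        rw [h]
        abel
      φ_ξ_left := fun a x ↦ (T x).φ_ξ_left a
      φ_ξ_right := fun a x ↦ neg_eq_iff_eq_neg.2 ((T x).φ_ξ_right a)
      η_φ_left := fun a x v ↦ (T x).η_φ_left a v
      η_φ_right := fun a x v ↦ neg_eq_iff_eq_neg.2 ((T x).η_φ_right a v)
      η_ξ_left := fun a x ↦ (T x).η_ξ_left a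
      η_ξ_right := fun a x ↦ (T x).η_ξ_right a }
  exact ⟨S, hT⟩

/-- Used for the boundedness of metric unit balls that a Riemannian metric requires; the norm of the
model is a maximum of coordinate norms. -/
theorem norm_le_one_of_modelInner_lt_one {p : CoquaternionModel n} (hp : modelInner n p p < 1) :
    ‖p‖ ≤ 1 := by
  have h1 : ∀ i ∈ Finset.univ, 0 ≤ inner ℝ (p.1 i) (p.1 i) := fun i _ ↦ real_inner_self_nonneg
  have h2 : ∀ a ∈ Finset.univ, 0 ≤ p.2 a * p.2 a := fun i _ ↦ mul_self_nonneg _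
  rw [modelInner_apply] at hp
  refine max_le ((pi_norm_le_iff_of_nonneg zero_le_one).2 fun i ↦ ?_)
    ((pi_norm_le_iff_of_nonneg zero_le_one).2 fun a ↦ ?_)
  · have h3 := Finset.single_le_sum h1 (Finset.mem_univ i)
    rw [real_inner_self_eq_norm_sq] at h3
    have h4 := Finset.sum_nonneg h2
    nlinarith [norm_nonneg (p.1 i)]
  · have h3 := Finset.single_le_sum h2 (Finset.mem_univ a)
    rw [← abs_mul_abs_self, ← Real.norm_eq_abs] at h3
    have h4 := Finset.sum_nonneg h1
    nlinarith [norm_nonneg (p.2 a)]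

theorem coquaternionSp_le_coquaternionGL : coquaternionSp n ≤ coquaternionGL n := by
  rintro _ ⟨A, rfl⟩
  exact ⟨_, rfl⟩

theorem nonempty_almostCoquaternionMetricStructure
    (h : TangentStructureGroupReducesTo (coquaternionSp n) (4 * n + 3) M) :
    Nonempty (AlmostCoquaternionMetricStructure (4 * n + 3) M) := by
  obtain ⟨𝒜, hcov, htrans⟩ := h
  obtain ⟨S, hS⟩ := exists_almostCoquaternionStructure_of_frames hcov
    fun e he e' he' x hx ↦ coquaternionSp_le_coquaternionGL (htrans e he e' he' x hx)
  choose c hc hxc using hcov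
  let g : ∀ x : M, TangentSpace (𝓡 (4 * n + 3)) x →L[ℝ] TangentSpace (𝓡 (4 * n + 3)) x →L[ℝ] ℝ :=
    fun x ↦ continuousBilin ((modelInner n).compl₁₂ ((c x).frame x).symm.toLinearEquiv.toLinearMap
      ((c x).frame x).symm.toLinearEquiv.toLinearMap)
  have hg : ∀ x v w, g x v w =
      modelInner n (((c x).frame x).symm v) (((c x).frame x).symm w) := fun x v w ↦ rfl
  -- Invariance of `modelInner` under `Sp(n)` makes the metric independent of the chosen frame.
  have hgf : ∀ e ∈ 𝒜, ∀ x ∈ e.U, ∀ p q, g x (e.frame x p) (e.frame x q) = modelInner n p q :=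
    fun e he x hx p q ↦
      (mem_coquaternionSp_iff.1 (htrans e he (c x) (hc x) x ⟨hx, hxc x⟩)).2 p q
  have hcomp : ∀ x, (S.system x).IsAdapted ((c x).frame x) := fun x ↦ hS _ (hc x) x (hxc x)
  let G : Bundle.ContMDiffRiemannianMetric (𝓡 (4 * n + 3)) ∞
      (EuclideanSpace ℝ (Fin (4 * n + 3))) (fun x : M ↦ TangentSpace (𝓡 (4 * n + 3)) x) :=
    { inner := g
      symm := fun x v w ↦ (isCompatible_model n).symm _ _
      pos := fun x v hv ↦ (isCompatible_model n).pos _ (by simpa using hv)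
      isVonNBounded := fun x ↦ by
        have h : Bornology.IsVonNBounded ℝ (Metric.closedBall (0 : CoquaternionModel n) 1) :=
          NormedSpace.isVonNBounded_closedBall ℝ _ 1
        refine (h.image ((c x).frame x : CoquaternionModel n →L[ℝ] _)).subset fun v hv ↦ ?_
        refine ⟨((c x).frame x).symm v, ?_, by simp⟩
        rw [mem_closedBall_zero_iff]
        exact norm_le_one_of_modelInner_lt_one hv
      contMDiff := fun x ↦ SmoothTangentFrame.contMDiffAt_bilin (e := c x)
        (continuousBilin (modelInner n))
        (fun y hy v w ↦ hgf (c x) (hc x) y hy v w) (hxc x) }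
  refine ⟨{ S with
    g := G
    η_eq := fun a x v ↦ ?_
    inner_φ_φ := fun a x v w ↦ ?_ }⟩
  · obtain ⟨p, rfl⟩ := ((c x).frame x).surjective v
    change (S.system x).η a _ = g x ((S.system x).ξ a) _
    rw [(hcomp x).η_map, ← (hcomp x).map_ξ, hgf _ (hc x) x (hxc x), (isCompatible_model n).η_eq]
  · obtain ⟨p, rfl⟩ := ((c x).frame x).surjective v
    obtain ⟨q, rfl⟩ := ((c x).frame x).surjective w
    change g x ((S.system x).φ a _) ((S.system x).φ a _) =
      g x _ _ - (S.system x).η a _ * (S.system x).η a _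
    rw [(hcomp x).η_map, (hcomp x).η_map, ← (hcomp x).map_φ, ← (hcomp x).map_φ,
      hgf _ (hc x) x (hxc x), hgf _ (hc x) x (hxc x), (isCompatible_model n).map_φ_φ]

end Reduction

/-! ### Orientability from a reduction with positive determinants. -/

section Orientation

variable {m : ℕ} {M : Type*} [TopologicalSpace M] [ChartedSpace (EuclideanSpace ℝ (Fin m)) M]
  [IsManifold (𝓡 m) ∞ M] {F : Type*} [NormedAddCommGroup F] [NormedSpace ℝ F]

/-- The differential of `c`, with respect to the frame `e` and an identification `ι` of the model
spaces. -/
def frameDeriv (ι : EuclideanSpace ℝ (Fin m) ≃L[ℝ] F) (c : M → EuclideanSpace ℝ (Fin m))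
    (e : SmoothTangentFrame F m M) (x : M) :
    EuclideanSpace ℝ (Fin m) →L[ℝ] EuclideanSpace ℝ (Fin m) :=
  ((mfderiv (𝓡 m) (𝓡 m) c x : TangentSpace (𝓡 m) x →L[ℝ] EuclideanSpace ℝ (Fin m)).comp
    (e.frame x : F →L[ℝ] TangentSpace (𝓡 m) x)).comp
    (ι : EuclideanSpace ℝ (Fin m) →L[ℝ] F)

/-- The determinant of the differential of `c`, with respect to the frame `e` and an identification
`ι` of the model spaces. -/
def frameDet (ι : EuclideanSpace ℝ (Fin m) ≃L[ℝ] F) (c : M → EuclideanSpace ℝ (Fin m))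
    (e : SmoothTangentFrame F m M) (x : M) : ℝ :=
  LinearMap.det (frameDeriv ι c e x).toLinearMap

theorem frameDet_neg (ι : EuclideanSpace ℝ (Fin m) ≃L[ℝ] F) (c : M → EuclideanSpace ℝ (Fin m))
    (e : SmoothTangentFrame F m M) (x : M) :
    frameDet ι (-c) e x = (-1) ^ m * frameDet ι c e x := by
  have h : (frameDeriv ι (-c) e x).toLinearMap = (-1 : ℝ) • (frameDeriv ι c e x).toLinearMap := by
    refine LinearMap.ext fun v ↦ ?_
    have h1 : frameDeriv ι (-c) e x v = -frameDeriv ι c e x v :=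
      congrArg (fun D ↦ D (e.frame x (ι v))) (mfderiv_neg (I := 𝓡 m) (f := c) (x := x))
    rw [LinearMap.smul_apply, neg_one_smul]
    exact h1
  rw [frameDet, h, LinearMap.det_smul, finrank_euclideanSpace_fin, frameDet]

/-- The trivialization at `x₀` is the differential of the preferred chart, so continuity and
nonvanishing of the determinant follow from those of `coordMap`. -/
theorem frameDet_chartAt (ι : EuclideanSpace ℝ (Fin m) ≃L[ℝ] F) (e : SmoothTangentFrame F m M)
    {x₀ x : M} (hx : x ∈ (chartAt (EuclideanSpace ℝ (Fin m)) x₀).source) :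
    frameDet ι (chartAt (EuclideanSpace ℝ (Fin m)) x₀) e x =
      ((e.coordMap x₀ x).comp (ι : EuclideanSpace ℝ (Fin m) →L[ℝ] F)).det := by
  rw [SmoothTangentFrame.coordMap]
  have h := TangentBundle.continuousLinearMapAt_trivializationAt (I := 𝓡 m) hx
  have h' : (extChartAt (𝓡 m) x₀ : M → EuclideanSpace ℝ (Fin m)) =
    chartAt (EuclideanSpace ℝ (Fin m)) x₀ := rfl
  rw [h'] at h
  rw [frameDet, frameDeriv, ← h]
  rfl

/-- Changing the frame by an orientation preserving automorphism does not change the sign. -/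
theorem frameDet_pos_of_pos (ι : EuclideanSpace ℝ (Fin m) ≃L[ℝ] F)
    {c : M → EuclideanSpace ℝ (Fin m)} {e e' : SmoothTangentFrame F m M} {x : M}
    (h : 0 < LinearMap.det (((e'.frame x).trans (e.frame x).symm : F ≃L[ℝ] F) : F →ₗ[ℝ] F))
    (he : 0 < frameDet ι c e x) : 0 < frameDet ι c e' x := by
  set T := (e'.frame x).trans (e.frame x).symm with hT
  have h1 : (frameDeriv ι c e' x).toLinearMap = (frameDeriv ι c e x).toLinearMap ∘ₗ
      (ι.toLinearEquiv.symm.toLinearMap ∘ₗ (T : F →ₗ[ℝ] F) ∘ₗ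
        ι.toLinearEquiv.symm.symm.toLinearMap) := by
    refine LinearMap.ext fun v ↦ ?_
    have h2 : e.frame x (ι (ι.symm (T (ι v)))) = e'.frame x (ι v) := by simp [T]
    exact congrArg (mfderiv (𝓡 m) (𝓡 m) c x) h2.symm
  rw [frameDet, h1, LinearMap.det_comp, LinearMap.det_conj]
  exact mul_pos he h

theorem frameDet_eq_fderiv_mul (ι : EuclideanSpace ℝ (Fin m) ≃L[ℝ] F)
    {c c' : OpenPartialHomeomorph M (EuclideanSpace ℝ (Fin m))}
    (hc : c ∈ IsManifold.maximalAtlas (𝓡 m) ∞ M) (hc' : c' ∈ IsManifold.maximalAtlas (𝓡 m) ∞ M)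
    (e : SmoothTangentFrame F m M) {x : M} (hx : x ∈ c.source) (hx' : x ∈ c'.source) :
    frameDet ι c' e x = (fderiv ℝ (c.symm.trans c') (c x)).det * frameDet ι c e x := by
  have hd : MDifferentiableAt (𝓡 m) (𝓡 m) c x :=
    (contMDiffAt_of_mem_maximalAtlas hc hx).mdifferentiableAt (by simp)
  have hd' : MDifferentiableAt (𝓡 m) (𝓡 m) (c.symm.trans c') (c x) := by
    have h1 : MDifferentiableAt (𝓡 m) (𝓡 m) c.symm (c x) :=
      (contMDiffAt_symm_of_mem_maximalAtlas hc (c.map_source hx)).mdifferentiableAt (by simp)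
    have h2 : MDifferentiableAt (𝓡 m) (𝓡 m) c' (c.symm (c x)) := by
      rw [c.left_inv hx]
      exact (contMDiffAt_of_mem_maximalAtlas hc' hx').mdifferentiableAt (by simp)
    exact h2.comp (c x) h1
  have heq : (c' : M → EuclideanSpace ℝ (Fin m)) =ᶠ[nhds x] (c.symm.trans c') ∘ c := by
    filter_upwards [c.open_source.mem_nhds hx] with y hy
    simp [c.left_inv hy]
  have h : mfderiv (𝓡 m) (𝓡 m) c' x =
      (mfderiv (𝓡 m) (𝓡 m) (c.symm.trans c') (c x)).comp (mfderiv (𝓡 m) (𝓡 m) c x) :=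
    heq.mfderiv_eq.trans (mfderiv_comp x hd' hd)
  rw [mfderiv_eq_fderiv] at h
  have h1 : (frameDeriv ι c' e x).toLinearMap =
      (fderiv ℝ (c.symm.trans c') (c x)).toLinearMap ∘ₗ (frameDeriv ι c e x).toLinearMap := by
    rw [frameDeriv, h]
    rfl
  rw [frameDet, h1, LinearMap.det_comp]
  rfl

/-- The preferred chart is shrunk to where the determinant keeps its sign at `x₀`; if that sign is
negative, the chart is composed with `-1`, which flips it because `m` is odd. -/
theorem exists_pos_chart [FiniteDimensional ℝ F] (hm : Odd m)
    (ι : EuclideanSpace ℝ (Fin m) ≃L[ℝ] F) {e : SmoothTangentFrame F m M} {x₀ : M}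
    (hx₀ : x₀ ∈ e.U) :
    ∃ c ∈ IsManifold.maximalAtlas (𝓡 m) ∞ M, x₀ ∈ c.source ∧ c.source ⊆ e.U ∧
      ∀ x ∈ c.source, 0 < frameDet ι c e x := by
  let c₀ := chartAt (EuclideanSpace ℝ (Fin m)) x₀
  have hx₀' : x₀ ∈ c₀.source := mem_chart_source _ x₀
  have hc₀ : c₀ ∈ IsManifold.maximalAtlas (𝓡 m) ∞ M := IsManifold.chart_mem_maximalAtlas x₀
  have hcont : ContinuousOn (frameDet ι c₀ e) (c₀.source ∩ e.U) := by
    have h : ContinuousOn (fun x ↦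
        ((e.coordMap x₀ x).comp (ι : EuclideanSpace ℝ (Fin m) →L[ℝ] F)).det)
        (c₀.source ∩ e.U) := fun x hx ↦
      (ContinuousLinearMap.continuous_det.continuousAt.comp
        ((SmoothTangentFrame.contMDiffAt_coordMap hx.2 hx.1).continuousAt.clm_comp
          continuousAt_const)).continuousWithinAt
    exact h.congr fun x hx ↦ frameDet_chartAt ι e hx.1
  have hopen : IsOpen (c₀.source ∩ e.U) := c₀.open_source.inter e.isOpen_U
  have hne : frameDet ι c₀ e x₀ ≠ 0 := by
    obtain ⟨A, hA⟩ := SmoothTangentFrame.isInvertible_coordMap (e := e) hx₀'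
    rw [frameDet_chartAt ι e hx₀', ← hA]
    exact (LinearEquiv.isUnit_det' (ι.trans A).toLinearEquiv).ne_zero
  rcases hne.lt_or_gt with hneg | hpos
  · let s : Set M := (c₀.source ∩ e.U) ∩ frameDet ι c₀ e ⁻¹' Set.Iio 0
    have hs : IsOpen s := hcont.isOpen_inter_preimage hopen isOpen_Iio
    let c := (c₀.restrOpen s hs).transHomeomorph (Homeomorph.neg (EuclideanSpace ℝ (Fin m)))
    have hcs : c.source = c₀.source ∩ s := rfl
    have hcc : (c : M → EuclideanSpace ℝ (Fin m)) = -c₀ := rfl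
    have hcmem : c ∈ IsManifold.maximalAtlas (𝓡 m) ∞ M := by
      refine (IsManifold.mem_maximalAtlas_iff_contMDiffOn _).2 ⟨?_, ?_⟩
      · exact ((contMDiffOn_of_mem_maximalAtlas hc₀).mono Set.inter_subset_left).neg
      · refine (contMDiffOn_symm_of_mem_maximalAtlas hc₀).comp
          (t := c₀.target) (contMDiffOn_id.neg) ?_
        intro y hy
        exact hy.1
    refine ⟨c, hcmem, ⟨hx₀', ⟨hx₀', hx₀⟩, hneg⟩, fun x hx ↦ hx.2.1.2, fun x hx ↦ ?_⟩
    have hneg : frameDet ι c₀ e x < 0 := hx.2.2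
    rw [hcc, frameDet_neg, hm.neg_one_pow]
    linarith
  · let s : Set M := (c₀.source ∩ e.U) ∩ frameDet ι c₀ e ⁻¹' Set.Ioi 0
    have hs : IsOpen s := hcont.isOpen_inter_preimage hopen isOpen_Ioi
    refine ⟨c₀.restrOpen s hs, ?_, ⟨hx₀', ⟨hx₀', hx₀⟩, hpos⟩, fun x hx ↦ hx.2.1.2,
      fun x hx ↦ hx.2.2⟩
    refine (IsManifold.mem_maximalAtlas_iff_contMDiffOn _).2 ⟨?_, ?_⟩
    · exact (contMDiffOn_of_mem_maximalAtlas hc₀).mono Set.inter_subset_left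
    · exact (contMDiffOn_symm_of_mem_maximalAtlas hc₀).mono fun y hy ↦ hy.1

/-- A manifold of odd dimension is orientable if its tangent bundle reduces to a group of
automorphisms of positive determinant. -/
theorem isOrientableManifold_of_reduction [FiniteDimensional ℝ F] (hm : Odd m)
    (ι : EuclideanSpace ℝ (Fin m) ≃L[ℝ] F) {G : Subgroup (F ≃L[ℝ] F)}
    (hG : ∀ T ∈ G, 0 < LinearMap.det (T : F →ₗ[ℝ] F)) (h : TangentStructureGroupReducesTo G m M) :
    IsOrientableManifold m M := by
  obtain ⟨𝒜, hcov, htrans⟩ := h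
  -- Charts positive on every frame of the reduction. By the chain rule, the Jacobian of a
  -- transition map is a quotient of two positive frame determinants.
  refine ⟨{c ∈ IsManifold.maximalAtlas (𝓡 m) ∞ M | ∀ x ∈ c.source, ∀ e ∈ 𝒜, x ∈ e.U →
    0 < frameDet ι c e x}, fun c hc ↦ hc.1, fun x ↦ ?_, fun c hc c' hc' y hy ↦ ?_⟩
  · obtain ⟨e, he, hx⟩ := hcov x
    obtain ⟨c, hc, hxc, hce, hpos⟩ := exists_pos_chart hm ι hx
    exact ⟨c, ⟨hc, fun y hy e' he' hy' ↦ frameDet_pos_of_pos ι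
      (hG _ (htrans e' he' e he y ⟨hy', hce hy⟩)) (hpos y hy)⟩, hxc⟩
  · obtain ⟨e, he, hx⟩ := hcov (c.symm y)
    have hyt : y ∈ c.target := hy.1
    have hxs : c.symm y ∈ c.source := c.map_target hyt
    have h := frameDet_eq_fderiv_mul ι hc.1 hc'.1 e hxs hy.2
    rw [c.right_inv hyt] at h
    exact pos_of_mul_pos_left (h ▸ hc'.2 _ hy.2 e he hx) (hc.2 _ hxs e he hx).le

end Orientation

end

theorem theorem1p7 (n : ℕ) (M : Type*) [TopologicalSpace M]
    [ChartedSpace (EuclideanSpace ℝ (Fin (4 * n + 3))) M]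
    [IsManifold (𝓡 (4 * n + 3)) ∞ M] :
    (Nonempty (AlmostCoquaternionStructure (4 * n + 3) M) ↔
      TangentStructureGroupReducesTo (coquaternionGL n) (4 * n + 3) M) ∧
    (Nonempty (AlmostCoquaternionMetricStructure (4 * n + 3) M) ↔
      TangentStructureGroupReducesTo (coquaternionSp n) (4 * n + 3) M) ∧
    (Nonempty (AlmostCoquaternionStructure (4 * n + 3) M) →
      IsOrientableManifold (4 * n + 3) M) := by
  refine ⟨⟨fun ⟨S⟩ ↦ tangentStructureGroupReducesTo_coquaternionGL S, fun ⟨𝒜, hcov, htrans⟩ ↦ ?_⟩,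
    ⟨fun ⟨S⟩ ↦ tangentStructureGroupReducesTo_coquaternionSp S,
      nonempty_almostCoquaternionMetricStructure⟩, fun ⟨S⟩ ↦ ?_⟩
  · obtain ⟨S, -⟩ := exists_almostCoquaternionStructure_of_frames hcov htrans
    exact ⟨S⟩
  · refine isOrientableManifold_of_reduction ⟨2 * n + 1, by ring⟩
      (ContinuousLinearEquiv.ofFinrankEq ?_)
      (fun T hT ↦ CoquaternionSystem.det_coquaternionGL_pos hT)
      (tangentStructureGroupReducesTo_coquaternionGL S)
    rw [finrank_euclideanSpace_fin, CoquaternionSystem.finrank_coquaternionModel]
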